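/- **Setting.** Let $(X,d_X)$ be a complete separable metric space with a non-negative Borel (Radon) measure $m$ that is finite on bounded sets, and let $(Y,d_Y)$ be a complete (not necessarily separable) metric space. For a metric space $Z$, $\mathrm{LIP}_{bd}(Z)$ is the set of functions $f:Z\to\mathbb R$ that are Lipschitz on every bounded set, $\mathrm{LIP}(Z)$ the set of Lipschitz functions, $\mathrm{Lip}(f)$ the global Lipschitz constant, and $$\mathrm{lip}_a(f)(x):=\limsup_{y,z\to x,\ y\ne z}\frac{|f(y)-f(z)|}{d_Z(y,z)}\quad(:=0\text{ if }x\text{ is isolated}).$$ For a Borel measure $\nu$ on $Z$ that is finite on bounded sets, $f\in L^0(\nu)$ belongs to $S^2(Z,d_Z,\nu)$ if there are $G\in L^2(\nu)$ and $(f_n)\subset \mathrm{LIP}_{bd}(Z)$ with $f_n\to f$ in $L^0(\nu)$ (in measure on sets of finite measure) and $\mathrm{lip}_a(f_n)\rightharpoonup G$ weakly in $L^2(\nu)$. The least such $G$ in the $\nu$-a.e. sense is denoted $|d_\nu f|$; it is the minimal weak upper gradient of $f$. Write $S^2(X):=S^2(X,d_X,m)$ and $|df|:=|d_mf|$. $S^2(X,Y)$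 is the set of Borel maps $u:X\to Y$ that are essentially separably valued ($u(X\setminus N)$ is separable for some $m$-null set $N$) and for which there is $G\in L^2(m)$, $G\ge 0$, such that for every $f\in \mathrm{LIP}(Y)$ one has $f\circ u\in S^2(X)$ and $|d(f\circ u)|\le \mathrm{Lip}(f)\,G$ $m$-a.e. The least such $G$ in the $m$-a.e. sense is denoted $|Du|$. **Proposition.** Let $u\in S^2(X,Y)$, put $\mu:=u_*(|Du|^2m)$, and let $f\in S^2(Y,d_Y,\mu)$. Then there is $g\in S^2(X)$ such that $g=f\circ u$ $m$-a.e. on $\{|Du|>0\}$ and $$|dg|\le |d_\mu f|\circ u\;|Du|\qquad m\text{-a.e.}$$ More precisely, $g$ can be chosen so that, in addition, there is a sequence $(f_n)\subset \mathrm{LIP}_{bd}(Y)$ with - $f_n\to f$ $\mu$-a.e.; - $\mathrm{lip}_a(f_n)\to |d_\mu f|$ in $L^2(\mu)$; - $f_n\circ u\to g$ $m$-a.e.; - $\mathrm{lip}_a(f_n)\circ u\,|Du|\to |d_\mu f|\circ u\,|Du|$ in $L^2(m)$. Here it is part of the claim that the least functions $|Du|$, $|d_\mu f|$ and $|dg|$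 exist. -/

import Mathlib

open MeasureTheory Filter Topology
open scoped ENNReal NNReal

noncomputable section

/-- `LIP_bd(X)`: real functions that are Lipschitz on every bounded set. -/
def LipBd {X : Type*} [MetricSpace X] (f : X → ℝ) : Prop :=
  ∀ s : Set X, Bornology.IsBounded s → ∃ K : ℝ≥0, LipschitzOnWith K f s

/-- The asymptotic Lipschitz constant `lip_a f : X → [0,∞]`,
`lip_a f x = limsup_{y,z → x, y ≠ z} |f y - f z| / d(y,z)`.
At an isolated point the filter is trivial and the limsup is `0` (see `lipA_of_isolated`). -/
def lipA {X : Type*} [MetricSpace X] (f : X → ℝ) (x : X) : ℝ≥0∞ :=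
  limsup (fun p : X × X => ENNReal.ofReal (|f p.1 - f p.2| / dist p.1 p.2))
    (𝓝[{p : X × X | p.1 ≠ p.2}] (x, x))

theorem lipA_of_isolated {X : Type*} [MetricSpace X] (f : X → ℝ) (x : X)
    (hx : 𝓝 x = pure x) : lipA f x = 0 := by
  have h : 𝓝[{p : X × X | p.1 ≠ p.2}] (x, x) = ⊥ := by
    rw [nhdsWithin, nhds_prod_eq, hx, prod_pure_pure, ← principal_singleton,
      inf_principal, principal_eq_bot_iff]
    ext p
    simp only [Set.mem_inter_iff, Set.mem_singleton_iff, Set.mem_ofPred_eq,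
      Set.mem_empty_iff_false, iff_false, not_and, not_not]
    rintro rfl
    rfl
  rw [lipA, h, limsup_bot]
  rfl

/-- The real-valued version of `lip_a f`. It is only used for `f` in `LIP_bd`, where `lip_a f` is
finite everywhere. -/
def lipAReal {X : Type*} [MetricSpace X] (f : X → ℝ) (x : X) : ℝ :=
  (lipA f x).toReal

/-- Convergence of a sequence in `L⁰(m)`: convergence in measure on every measurable set of finite
measure. -/
def TendstoL0 {X : Type*} [MeasurableSpace X] (m : Measure X) (fn : ℕ → X → ℝ) (f : X → ℝ) :
    Prop :=
  ∀ s : Set X, MeasurableSet s → m s < ∞ → TendstoInMeasure (m.restrict s) fn atTop f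

/-- Weak convergence of a sequence in `L²(m)`. -/
def TendstoWeakL2 {X : Type*} [MeasurableSpace X] (m : Measure X) (Gn : ℕ → X → ℝ) (G : X → ℝ) :
    Prop :=
  (∀ n, MemLp (Gn n) 2 m) ∧ MemLp G 2 m ∧
    ∀ h : X → ℝ, MemLp h 2 m →
      Tendsto (fun n => ∫ x, Gn n x * h x ∂m) atTop (𝓝 (∫ x, G x * h x ∂m))

/-- Strong convergence of a sequence in `L²(m)`. -/
def TendstoStrongL2 {X : Type*} [MeasurableSpace X] (m : Measure X) (Gn : ℕ → X → ℝ)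
    (G : X → ℝ) : Prop :=
  (∀ n, MemLp (Gn n) 2 m) ∧ MemLp G 2 m ∧
    Tendsto (fun n => eLpNorm (fun x => Gn n x - G x) 2 m) atTop (𝓝 0)

/-- The set of those `G ∈ L²(m)` that are weak `L²(m)`-limits of `lip_a (f_n)` for some sequence
`(f_n)` in `LIP_bd(X)` that converges to `f` in `L⁰(m)`. -/
def relaxedSlopes {X : Type*} [MetricSpace X] [MeasurableSpace X] (m : Measure X) (f : X → ℝ) :
    Set (X → ℝ) :=
  {G | ∃ fn : ℕ → X → ℝ, (∀ n, LipBd (fn n)) ∧ TendstoL0 m fn f ∧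
    TendstoWeakL2 m (fun n => lipAReal (fn n)) G}

/-- The Sobolev class `S²(X, d, m)`. -/
def MemS2 {X : Type*} [MetricSpace X] [MeasurableSpace X] (m : Measure X) (f : X → ℝ) : Prop :=
  AEStronglyMeasurable f m ∧ (relaxedSlopes m f).Nonempty

/-- `G` is a least element of `S` in the `m`-a.e. sense. -/
def IsLeastAE {X : Type*} [MeasurableSpace X] (m : Measure X) (S : Set (X → ℝ)) (G : X → ℝ) :
    Prop :=
  G ∈ S ∧ ∀ G' ∈ S, G ≤ᵐ[m] G'

open Classical in
/-- A representative of the least element, in the `m`-a.e. sense, of `S` (`0` if there is none). -/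
def leastAE {X : Type*} [MeasurableSpace X] (m : Measure X) (S : Set (X → ℝ)) : X → ℝ :=
  if h : ∃ G, IsLeastAE m S G then h.choose else 0

/-- The minimal weak upper gradient `|D f| = |d_m f|` of `f ∈ S²(X, d, m)`. -/
def minimalWUG {X : Type*} [MetricSpace X] [MeasurableSpace X] (m : Measure X) (f : X → ℝ) :
    X → ℝ :=
  leastAE m (relaxedSlopes m f)

/-- The set of those nonnegative `G ∈ L²(m)` such that, for all Lipschitz `f : Y → ℝ`,
`f ∘ u ∈ S²(X)` and `|d (f ∘ u)| ≤ Lip(f) G` `m`-a.e. (The bound is stated for every Lipschitz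
constant `K` of `f`; the least one is `Lip(f)`.) -/
def mapUpperGradients {X Y : Type*} [MetricSpace X] [MeasurableSpace X] [MetricSpace Y]
    (m : Measure X) (u : X → Y) : Set (X → ℝ) :=
  {G | MemLp G 2 m ∧ 0 ≤ᵐ[m] G ∧ ∀ (K : ℝ≥0) (f : Y → ℝ), LipschitzWith K f →
    MemS2 m (f ∘ u) ∧ ∀ᵐ x ∂m, minimalWUG m (f ∘ u) x ≤ K * G x}

/-- The class `S²(X, Y)` of metric-valued Sobolev maps. -/
def MemS2Map {X Y : Type*} [MetricSpace X] [MeasurableSpace X] [MetricSpace Y]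
    [MeasurableSpace Y] (m : Measure X) (u : X → Y) : Prop :=
  Measurable u ∧
    (∃ N : Set X, m N = 0 ∧ TopologicalSpace.IsSeparable (u '' Nᶜ)) ∧
    (mapUpperGradients m u).Nonempty

/-- The function `|D u|` of `u ∈ S²(X, Y)`. -/
def mapWUG {X Y : Type*} [MetricSpace X] [MeasurableSpace X] [MetricSpace Y]
    (m : Measure X) (u : X → Y) : X → ℝ :=
  leastAE m (mapUpperGradients m u)

/-- The measure `μ = u_* (|D u|² m)` on `Y`. -/
def energyMeasure {X Y : Type*} [MetricSpace X] [MeasurableSpace X] [MetricSpace Y]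
    [MeasurableSpace Y] (m : Measure X) (u : X → Y) : Measure Y :=
  (m.withDensity (fun x => ENNReal.ofReal (mapWUG m u x ^ 2))).map u

end

/-! The difficulty is that `f` is determined only up to `μ`-null sets, and `μ` does not see the
image of `{|Du| = 0}`. Functions `f_n` in `LIP_bd(Y)` that approximate `f` with `lip_a f_n → |d_μ
f|` in `L²(μ)` satisfy the chain rule `|d(f_n ∘ u)| ≤ lip_a f_n ∘ u |Du|`, and the right-hand sides
converge in `L²(m)`, because `h ↦ h ∘ u |Du|` is an isometry from `L²(μ)` into `L²(m)`. But `f_n ∘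
u` need not converge where `|Du| = 0`. So `f` must be redefined off a `μ`-null set, and the `f_n`
changed, so that convergence holds almost everywhere for the larger measure `u_* m` (replaced by an
equivalent finite measure).

This is `ApproxSlope.exists_extension`. All truncations of the `f_n` are bounded, so common convex
combinations of them converge almost everywhere for the large measure. Convex combinations and
`1`-Lipschitz post-compositions do not spoil the bound on `lip_a`. Monotone limits in the truncation
levels give a function with values in `[-∞, ∞]`, equal to `f` `μ`-a.e.; infinite values are removed
by folding the line, since `fold K` extends continuously by `0` to `±∞`.

The technical tool is `ApproxSlope ν μ f G`: functions approach `f` for a finite measure `ν`, and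
their slopes are bounded by `G` up to a small error in `L²(μ)`. Unlike weak limits, this notion is
visibly closed under limits (`ApproxSlope.of_tendsto`). Mazur's lemma shows that relaxed slopes are
approximate slopes. Slopes can be glued along Borel sets (`ApproxSlope.glue`), so a least one
exists, and a Hilbert space argument makes it a strong limit of `lip_a` along any suitable
approximating sequence (`SlopeSeq.exists_tendstoStrongL2`). Hence both notions have the same least
element.

The chain rule itself comes from locality of the minimal slope: near a point of `Y`, a function
agrees with a global Lipschitz function whose constant is almost `lip_a` there, and countably many
balls suffice because `u` is essentially separably valued. -/

/-- `f` is `K`-Lipschitz on some neighbourhood of `x`. -/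
def LipNear {X : Type*} [MetricSpace X] (K : ℝ) (f : X → ℝ) (x : X) : Prop :=
  ∃ U ∈ 𝓝 x, ∀ y ∈ U, ∀ z ∈ U, |f y - f z| ≤ K * dist y z

/-! ### Calculus of the asymptotic Lipschitz constant -/

section AsymptoticLipschitz

variable {X : Type*} [MetricSpace X] {f g : X → ℝ} {x : X} {K L : ℝ}

theorem LipNear.lipA_le (h : LipNear K f x) : lipA f x ≤ ENNReal.ofReal K := by
  obtain ⟨U, hU, h⟩ := h
  refine limsup_le_of_le (by isBoundedDefault) ?_
  have h1 : U ×ˢ U ∈ 𝓝 (x, x) := prod_mem_nhds hU hU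
  filter_upwards [mem_nhdsWithin_of_mem_nhds h1, self_mem_nhdsWithin] with p hp hne
  apply ENNReal.ofReal_le_ofReal
  have : 0 < dist p.1 p.2 := dist_pos.2 hne
  rw [div_le_iff₀ this]
  exact h _ hp.1 _ hp.2

/-- With `LipNear.lipA_le` this reduces every estimate on `lip_a` to difference quotients on a
neighbourhood. The strict inequality is what turns a limsup into a bound near the point. -/
theorem LipNear.of_lipA_lt (h : lipA f x < ENNReal.ofReal K) : LipNear K f x := by
  have hK : 0 < K := by
    by_contra hK
    rw [ENNReal.ofReal_of_nonpos (not_lt.1 hK)] at h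
    exact not_lt_zero h
  have h1 := eventually_lt_of_limsup_lt h (by isBoundedDefault)
  rw [eventually_nhdsWithin_iff, nhds_prod_eq] at h1
  obtain ⟨U, hU, h2⟩ := mem_prod_self_iff.1 h1
  refine ⟨U, hU, fun y hy z hz => ?_⟩
  by_cases hyz : y = z
  · subst hyz; simp
  have h3 : ENNReal.ofReal (|f y - f z| / dist y z) < ENNReal.ofReal K :=
    h2 (Set.mk_mem_prod hy hz) hyz
  have : 0 < dist y z := dist_pos.2 hyz
  have h4 := (ENNReal.ofReal_lt_ofReal_iff hK).1 h3
  rw [div_lt_iff₀ this] at h4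
  exact h4.le

theorem LipNear.lipAReal_le (hK : 0 ≤ K) (h : LipNear K f x) : lipAReal f x ≤ K :=
  ENNReal.toReal_le_of_le_ofReal hK (h.lipA_le)

theorem LipBd.lipA_lt_top (hf : LipBd f) (x : X) : lipA f x < ∞ := by
  obtain ⟨K, hK⟩ := hf (Metric.ball x 1) Metric.isBounded_ball
  refine (LipNear.lipA_le (K := K)
    ⟨_, Metric.ball_mem_nhds x one_pos, fun y hy z hz => ?_⟩).trans_lt
    ENNReal.ofReal_lt_top
  rw [← Real.dist_eq]
  exact hK.dist_le_mul y hy z hz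

theorem LipBd.lipNear (hf : LipBd f) (h : lipAReal f x < K) : LipNear K f x :=
  .of_lipA_lt ((ENNReal.lt_ofReal_iff_toReal_lt (hf.lipA_lt_top x).ne).2 h)

theorem lipAReal_nonneg (f : X → ℝ) (x : X) : 0 ≤ lipAReal f x := ENNReal.toReal_nonneg

theorem LipBd.continuous (hf : LipBd f) : Continuous f := by
  rw [continuous_iff_continuousAt]
  intro x
  obtain ⟨K, hK⟩ := hf (Metric.ball x 1) Metric.isBounded_ball
  exact hK.continuousOn.continuousAt (Metric.ball_mem_nhds x one_pos)

theorem LipNear.congr (h : LipNear K f x) (hfg : f =ᶠ[𝓝 x] g) : LipNear K g x := by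
  obtain ⟨U, hU, h⟩ := h
  refine ⟨U ∩ {y | f y = g y}, inter_mem hU hfg, fun y hy z hz => ?_⟩
  rw [← hy.2, ← hz.2]
  exact h y hy.1 z hz.1

theorem LipNear.comp {φ : ℝ → ℝ} (hφ : ∀ s t, |φ s - φ t| ≤ |s - t|) (h : LipNear K f x) :
    LipNear K (fun y => φ (f y)) x := by
  obtain ⟨U, hU, h⟩ := h
  exact ⟨U, hU, fun y hy z hz => (hφ _ _).trans (h y hy z hz)⟩

theorem LipNear.combo {a b : ℝ} (ha : 0 ≤ a) (hb : 0 ≤ b) (hf : LipNear K f x)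
    (hg : LipNear L g x) : LipNear (a * K + b * L) (fun y => a * f y + b * g y) x := by
  obtain ⟨U, hU, hf⟩ := hf
  obtain ⟨V, hV, hg⟩ := hg
  refine ⟨U ∩ V, inter_mem hU hV, fun y hy z hz => ?_⟩
  have h1 := mul_le_mul_of_nonneg_left (hf y hy.1 z hz.1) ha
  have h2 := mul_le_mul_of_nonneg_left (hg y hy.2 z hz.2) hb
  calc |a * f y + b * g y - (a * f z + b * g z)| = |a * (f y - f z) + b * (g y - g z)| := by
        congr 1; ring
    _ ≤ |a * (f y - f z)| + |b * (g y - g z)| := abs_add_le _ _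
    _ = a * |f y - f z| + b * |g y - g z| := by
      rw [abs_mul, abs_mul, abs_of_nonneg ha, abs_of_nonneg hb]
    _ ≤ _ := by linarith

theorem LipNear.max (hf : LipNear K f x) (hg : LipNear K g x) :
    LipNear K (fun y => max (f y) (g y)) x := by
  obtain ⟨U, hU, hf⟩ := hf
  obtain ⟨V, hV, hg⟩ := hg
  exact ⟨U ∩ V, inter_mem hU hV, fun y hy z hz => (abs_max_sub_max_le_max _ _ _ _).trans
    (max_le (hf y hy.1 z hz.1) (hg y hy.2 z hz.2))⟩

theorem LipNear.min (hf : LipNear K f x) (hg : LipNear K g x) :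
    LipNear K (fun y => min (f y) (g y)) x := by
  obtain ⟨U, hU, hf⟩ := hf
  obtain ⟨V, hV, hg⟩ := hg
  exact ⟨U ∩ V, inter_mem hU hV, fun y hy z hz => (abs_min_sub_min_le_max _ _ _ _).trans
    (max_le (hf y hy.1 z hz.1) (hg y hy.2 z hz.2))⟩

theorem LipNear.mono (hKL : K ≤ L) (hf : LipNear K f x) : LipNear L f x := by
  obtain ⟨U, hU, hf⟩ := hf
  exact ⟨U, hU, fun y hy z hz => (hf y hy z hz).trans (by gcongr)⟩

theorem lipBd_iff : LipBd f ↔ ∀ s : Set X, Bornology.IsBounded s →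
    ∃ K : ℝ, ∀ y ∈ s, ∀ z ∈ s, |f y - f z| ≤ K * dist y z := by
  refine forall₂_congr fun s hs => ⟨fun ⟨K, hK⟩ => ⟨K, fun y hy z hz => ?_⟩, fun ⟨K, hK⟩ =>
    ⟨K.toNNReal, LipschitzOnWith.of_dist_le_mul fun y hy z hz => ?_⟩⟩
  · rw [← Real.dist_eq]; exact hK.dist_le_mul y hy z hz
  · rw [Real.dist_eq]
    exact (hK y hy z hz).trans (by gcongr; exact Real.le_coe_toNNReal K)

theorem LipBd.comp {φ : ℝ → ℝ} (hφ : ∀ s t, |φ s - φ t| ≤ |s - t|) (hf : LipBd f) :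
    LipBd (fun y => φ (f y)) := by
  rw [lipBd_iff] at hf ⊢
  intro s hs
  obtain ⟨K, hK⟩ := hf s hs
  exact ⟨K, fun y hy z hz => (hφ _ _).trans (hK y hy z hz)⟩

theorem LipBd.combo {a b : ℝ} (ha : 0 ≤ a) (hb : 0 ≤ b) (hf : LipBd f) (hg : LipBd g) :
    LipBd (fun y => a * f y + b * g y) := by
  rw [lipBd_iff] at hf hg ⊢
  intro s hs
  obtain ⟨K, hK⟩ := hf s hs
  obtain ⟨L, hL⟩ := hg s hs
  refine ⟨a * K + b * L, fun y hy z hz => ?_⟩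
  have h1 := mul_le_mul_of_nonneg_left (hK y hy z hz) ha
  have h2 := mul_le_mul_of_nonneg_left (hL y hy z hz) hb
  calc |a * f y + b * g y - (a * f z + b * g z)| = |a * (f y - f z) + b * (g y - g z)| := by
        congr 1; ring
    _ ≤ |a * (f y - f z)| + |b * (g y - g z)| := abs_add_le _ _
    _ = a * |f y - f z| + b * |g y - g z| := by
      rw [abs_mul, abs_mul, abs_of_nonneg ha, abs_of_nonneg hb]
    _ ≤ _ := by linarith

theorem LipBd.neg (hf : LipBd f) : LipBd (fun y => -f y) :=
  hf.comp (φ := fun t => -t) fun s t => by rw [← abs_neg]; apply le_of_eq; congr 1; ring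

theorem LipBd.max (hf : LipBd f) (hg : LipBd g) : LipBd (fun y => max (f y) (g y)) := by
  rw [lipBd_iff] at hf hg ⊢
  intro s hs
  obtain ⟨K, hK⟩ := hf s hs
  obtain ⟨L, hL⟩ := hg s hs
  refine ⟨Max.max K L, fun y hy z hz => (abs_max_sub_max_le_max _ _ _ _).trans (max_le ?_ ?_)⟩
  · exact (hK y hy z hz).trans (by gcongr; exact le_max_left _ _)
  · exact (hL y hy z hz).trans (by gcongr; exact le_max_right _ _)

theorem LipBd.min (hf : LipBd f) (hg : LipBd g) : LipBd (fun y => min (f y) (g y)) := by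
  have := (hf.neg.max hg.neg).neg
  simpa [max_neg_neg] using this

theorem LipschitzWith.lipBd {K : ℝ≥0} (hf : LipschitzWith K f) : LipBd f :=
  fun _ _ => ⟨K, hf.lipschitzOnWith⟩

theorem lipAReal_le_of_forall (c : ℝ) (h : ∀ ε > 0, LipNear (c + ε) f x) (hc : 0 ≤ c) :
    lipAReal f x ≤ c :=
  le_of_forall_pos_le_add fun ε hε => (h ε hε).lipAReal_le (by positivity)

theorem LipBd.lipNear_add (hf : LipBd f) {ε : ℝ} (hε : 0 < ε) (x : X) :
    LipNear (lipAReal f x + ε) f x := hf.lipNear (lt_add_of_pos_right _ hε)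

theorem lipAReal_congr (hf : LipBd f) (hfg : f =ᶠ[𝓝 x] g) : lipAReal g x ≤ lipAReal f x :=
  lipAReal_le_of_forall _ (fun _ hε => (hf.lipNear_add hε x).congr hfg) (lipAReal_nonneg _ _)

theorem lipAReal_comp_le {φ : ℝ → ℝ} (hφ : ∀ s t, |φ s - φ t| ≤ |s - t|) (hf : LipBd f) (x : X) :
    lipAReal (fun y => φ (f y)) x ≤ lipAReal f x :=
  lipAReal_le_of_forall _ (fun _ hε => (hf.lipNear_add hε x).comp hφ) (lipAReal_nonneg _ _)

theorem lipAReal_combo_le {a b : ℝ} (ha : 0 ≤ a) (hb : 0 ≤ b) (hf : LipBd f) (hg : LipBd g)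
    (x : X) :
    lipAReal (fun y => a * f y + b * g y) x ≤ a * lipAReal f x + b * lipAReal g x := by
  have h0 := lipAReal_nonneg f x
  have h0' := lipAReal_nonneg g x
  refine lipAReal_le_of_forall _ (fun ε hε => ?_) (by positivity)
  -- The summand `1` keeps the denominator positive when `a = b = 0`.
  have hd : 0 < ε / (a + b + 1) := by positivity
  refine ((hf.lipNear_add hd x).combo ha hb (hg.lipNear_add hd x)).mono ?_
  have : (a + b) * (ε / (a + b + 1)) ≤ ε := by
    rw [mul_div_assoc', div_le_iff₀ (by positivity)]
    nlinarith
  linarith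

theorem lipAReal_max_le (hf : LipBd f) (hg : LipBd g) (x : X) :
    lipAReal (fun y => max (f y) (g y)) x ≤ max (lipAReal f x) (lipAReal g x) :=
  lipAReal_le_of_forall _ (fun ε hε =>
    ((hf.lipNear_add hε x).mono (by gcongr; exact le_max_left _ _)).max
      ((hg.lipNear_add hε x).mono (by gcongr; exact le_max_right _ _)))
    (le_max_of_le_left (lipAReal_nonneg _ _))

theorem lipAReal_min_le (hf : LipBd f) (hg : LipBd g) (x : X) :
    lipAReal (fun y => min (f y) (g y)) x ≤ max (lipAReal f x) (lipAReal g x) :=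
  lipAReal_le_of_forall _ (fun ε hε =>
    ((hf.lipNear_add hε x).mono (by gcongr; exact le_max_left _ _)).min
      ((hg.lipNear_add hε x).mono (by gcongr; exact le_max_right _ _)))
    (le_max_of_le_left (lipAReal_nonneg _ _))

theorem lipAReal_const_near (c : ℝ) (h : f =ᶠ[𝓝 x] fun _ => c) : lipAReal f x ≤ 0 :=
  LipNear.lipAReal_le le_rfl <| LipNear.congr (f := fun _ => c)
    ⟨Set.univ, univ_mem, fun y _ z _ => by simp⟩ h.symm

theorem LipschitzWith.lipAReal_le {K : ℝ≥0} (hf : LipschitzWith K f) (x : X) :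
    lipAReal f x ≤ K :=
  LipNear.lipAReal_le K.2 ⟨Set.univ, univ_mem, fun y _ z _ => by
    rw [← Real.dist_eq]; exact hf.dist_le_mul y z⟩

/-- A Lipschitz bound near `x` is also one near every point of a neighbourhood of `x`, so `lip_a f`
is upper semicontinuous. -/
theorem LipBd.measurable_lipAReal [MeasurableSpace X] [BorelSpace X] (hf : LipBd f) :
    Measurable (lipAReal f) := by
  refine measurable_of_Iio fun t => IsOpen.measurableSet ?_
  rw [isOpen_iff_mem_nhds]
  intro x hx
  obtain ⟨K, hK, hKt⟩ := exists_between (show lipAReal f x < t from hx)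
  obtain ⟨U, hU, h⟩ := hf.lipNear hK
  have hK0 : 0 ≤ K := (lipAReal_nonneg f x).trans hK.le
  filter_upwards [eventually_mem_nhds_iff.2 hU] with y hy
  exact (LipNear.lipAReal_le hK0 ⟨U, hy, h⟩).trans_lt hKt

end AsymptoticLipschitz

/-! ### Convex combinations of tails of sequences in a Hilbert space -/

section ForwardConvexCombinations

variable {V E : Type*} [AddCommGroup V] [Module ℝ V] [NormedAddCommGroup E]
  [InnerProductSpace ℝ E]

/-- In the pairs, the first factor is to carry functions and the second their slopes, so that both
are averaged with the same coefficients. The topology is used only on the second factor. -/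
theorem snd_image_convexHull (s : Set (V × E)) :
    Prod.snd '' convexHull ℝ s = convexHull ℝ (Prod.snd '' s) :=
  (LinearMap.snd ℝ V E).image_convexHull s

/-- A bounded sequence in a Hilbert space has forward convex combinations that converge in norm. -/
theorem exists_convexHull_tendsto [CompleteSpace E] (p : ℕ → V × E) {C : ℝ}
    (hC : ∀ n, ‖(p n).2‖ ≤ C) :
    ∃ q : ℕ → V × E, (∀ n, q n ∈ convexHull ℝ (p '' Set.Ici n)) ∧
      ∃ l, Tendsto (fun n => (q n).2) atTop (𝓝 l) := by
  set A : ℕ → Set (V × E) := fun n => convexHull ℝ (p '' Set.Ici n) with hA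
  have hanti : ∀ {n k}, n ≤ k → A k ⊆ A n := fun h =>
    convexHull_mono (Set.image_mono (Set.Ici_subset_Ici.2 h))
  have hmem : ∀ n, p n ∈ A n := fun n => subset_convexHull ℝ _ ⟨n, Set.self_mem_Ici, rfl⟩
  set N : ℕ → Set ℝ := fun n => (fun v : V × E => ‖v.2‖) '' A n
  have hne : ∀ n, (N n).Nonempty := fun n => ⟨_, p n, hmem n, rfl⟩
  have hbdd : ∀ n, BddBelow (N n) := fun n => ⟨0, by rintro _ ⟨v, -, rfl⟩; exact norm_nonneg _⟩
  set d : ℕ → ℝ := fun n => sInf (N n)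
  have hdle : ∀ n v, v ∈ A n → d n ≤ ‖v.2‖ := fun n v hv => csInf_le (hbdd n) ⟨v, hv, rfl⟩
  have hd0 : ∀ n, 0 ≤ d n := fun n => le_csInf (hne n) (by rintro _ ⟨v, -, rfl⟩; exact norm_nonneg _)
  have hmono : Monotone d := fun n k h =>
    csInf_le_csInf (hbdd n) (hne k) (Set.image_mono (hanti h))
  have hdC : ∀ n, d n ≤ C := fun n => (hdle n _ (hmem n)).trans (hC n)
  have hlim := tendsto_atTop_ciSup hmono ⟨C, by rintro _ ⟨n, rfl⟩; exact hdC n⟩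
  set D := ⨆ n, d n
  have hdD : ∀ n, d n ≤ D := fun n => le_ciSup (f := d) ⟨C, by rintro _ ⟨n, rfl⟩; exact hdC n⟩ n
  have hex : ∀ n : ℕ, ∃ v ∈ A n, ‖v.2‖ < d n + 1 / ((n : ℝ) + 1) := by
    intro n
    obtain ⟨_, ⟨v, hv, rfl⟩, h⟩ := exists_lt_of_csInf_lt (hne n)
      (show sInf (N n) < d n + 1 / ((n : ℝ) + 1) from lt_add_of_pos_right _ (by positivity))
    exact ⟨v, hv, h⟩
  choose q hq hqn using hex
  refine ⟨q, hq, cauchySeq_tendsto_of_complete ?_⟩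
  -- The hulls `A n` decrease, so the minimal norms `d n` increase to a limit `D`. The midpoint of
  -- `q n` and `q k` lies in `A n` and has norm at least `d n`; the parallelogram law then bounds
  -- `‖q n - q k‖²` by `4 (D + 1/(n+1))² - 4 (d n)²`.
  refine cauchySeq_of_le_tendsto_0'
    (fun n : ℕ => √(4 * (D + 1 / ((n : ℝ) + 1)) ^ 2 - 4 * d n ^ 2)) (fun n k hnk => ?_) ?_
  · rw [dist_eq_norm]
    apply Real.le_sqrt_of_sq_le
    have hmid : (1 / 2 : ℝ) • q n + (1 / 2 : ℝ) • q k ∈ A n :=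
      (convex_convexHull ℝ _) (hq n) (hanti hnk (hq k)) (by norm_num) (by norm_num) (by norm_num)
    have h1 := hdle n _ hmid
    have h2 : ((1 / 2 : ℝ) • q n + (1 / 2 : ℝ) • q k).2 = (1 / 2 : ℝ) • ((q n).2 + (q k).2) := by
      simp
    rw [h2, norm_smul, Real.norm_of_nonneg (by norm_num)] at h1
    have hpar := parallelogram_law_with_norm ℝ (q n).2 (q k).2
    have e1 : ‖(q n).2‖ ≤ D + 1 / ((n : ℝ) + 1) := (hqn n).le.trans (by gcongr; exact hdD n)
    have e2 : ‖(q k).2‖ ≤ D + 1 / ((n : ℝ) + 1) :=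
      (hqn k).le.trans (by gcongr; exact hdD k)
    have e3 := pow_le_pow_left₀ (norm_nonneg _) e1 2
    have e4 := pow_le_pow_left₀ (norm_nonneg _) e2 2
    have e5 := pow_le_pow_left₀ (hd0 n) h1 2
    nlinarith
  · have h1 : Tendsto (fun n : ℕ => 4 * (D + 1 / ((n : ℝ) + 1)) ^ 2 - 4 * d n ^ 2) atTop
        (𝓝 (4 * (D + 0) ^ 2 - 4 * D ^ 2)) :=
      (((tendsto_one_div_add_atTop_nhds_zero_nat.const_add D).pow 2).const_mul 4).sub
        ((hlim.pow 2).const_mul 4)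
    have h2 := (Real.continuous_sqrt.tendsto _).comp h1
    simpa [Function.comp_def] using h2

/-- Mazur's lemma for a weakly convergent sequence in a Hilbert space. -/
theorem exists_convexHull_tendsto_of_weak [CompleteSpace E] (p : ℕ → V × E) (l : E)
    (hl : ∀ h : E, Tendsto (fun n => inner ℝ h (p n).2) atTop (𝓝 (inner ℝ h l))) :
    ∃ q : ℕ → V × E, (∀ n, q n ∈ convexHull ℝ (p '' Set.Ici n)) ∧
      Tendsto (fun n => (q n).2) atTop (𝓝 l) := by
  have hcl : ∀ n, l ∈ closure (convexHull ℝ (Prod.snd '' (p '' Set.Ici n))) := by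
    intro n
    by_contra hn
    -- A functional separating `l` from the closed hull of the `n`-th tail would contradict weak
    -- convergence of the tail to `l`.
    obtain ⟨φ, u, hφ, hu⟩ := geometric_hahn_banach_point_closed
      (convex_convexHull ℝ _).closure isClosed_closure hn
    set h := (InnerProductSpace.toDual ℝ E).symm φ
    have e : ∀ v, inner ℝ h v = φ v := fun v => InnerProductSpace.toDual_symm_apply
    have h1 := hl h
    simp only [e] at h1
    refine absurd (ge_of_tendsto h1 ?_) (not_le.2 hφ)
    filter_upwards [eventually_ge_atTop n] with k hk
    exact (hu _ (subset_closure (subset_convexHull ℝ _ ⟨p k, ⟨k, hk, rfl⟩, rfl⟩))).le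
  have hex : ∀ n : ℕ, ∃ v ∈ convexHull ℝ (p '' Set.Ici n), dist v.2 l < 1 / ((n : ℝ) + 1) := by
    intro n
    obtain ⟨y, hy, hd⟩ := Metric.mem_closure_iff.1 (hcl n) (1 / ((n : ℝ) + 1)) (by positivity)
    rw [← snd_image_convexHull] at hy
    obtain ⟨v, hv, rfl⟩ := hy
    exact ⟨v, hv, by rwa [dist_comm]⟩
  choose q hq hqd using hex
  refine ⟨q, hq, tendsto_iff_dist_tendsto_zero.2 ?_⟩
  exact squeeze_zero (fun _ => dist_nonneg) (fun n => (hqd n).le)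
    tendsto_one_div_add_atTop_nhds_zero_nat

/-- If `‖p n‖` is asymptotically at most `‖g‖` and limits of forward convex combinations have
inner product at least `‖g‖ ^ 2` with `g`, then some subsequence converges to `g`. -/
theorem exists_tendsto_of_inner_convexHull [CompleteSpace E] (p : ℕ → V × E) (g : E) (b : ℕ → ℝ)
    (hb : Tendsto b atTop (𝓝 0)) (hp : ∀ n, ‖(p n).2‖ ≤ ‖g‖ + b n)
    (H : ∀ (q : ℕ → V × E) (l : E), (∀ n, q n ∈ convexHull ℝ (p '' Set.Ici n)) →
      Tendsto (fun n => (q n).2) atTop (𝓝 l) → ‖g‖ ^ 2 ≤ inner ℝ g l) :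
    ∃ φ : ℕ → ℕ, (∀ n, n ≤ φ n) ∧ Tendsto (fun n => (p (φ n)).2) atTop (𝓝 g) := by
  obtain ⟨B, hB⟩ := hb.bddAbove_range
  have hbB : ∀ n, b n ≤ B := fun n => hB ⟨n, rfl⟩
  obtain ⟨q, hq, l, hl⟩ := exists_convexHull_tendsto p (C := ‖g‖ + B)
    (fun n => (hp n).trans (by gcongr; exact hbB n))
  have hgl := H q l hq hl
  have hex : ∀ n : ℕ, ∃ k, n ≤ k ∧ ‖g‖ ^ 2 - 1 / ((n : ℝ) + 1) ≤ inner ℝ g (p k).2 := by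
    intro n
    have h1 : Tendsto (fun n => inner ℝ g (q n).2) atTop (𝓝 (inner ℝ g l)) :=
      (continuous_const.inner continuous_id).continuousAt.tendsto.comp hl
    have h2 : ∀ᶠ j in atTop, ‖g‖ ^ 2 - 1 / ((n : ℝ) + 1) < inner ℝ g (q j).2 :=
      h1.eventually (lt_mem_nhds (by
        have : 0 < 1 / ((n : ℝ) + 1) := by positivity
        linarith))
    obtain ⟨j, hj, hnj⟩ := (h2.and (eventually_ge_atTop n)).exists
    -- If no late `p k` had a large inner product with `g`, the whole tail would lie in an open
    -- half-space, which would also contain its convex combination `q j`.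
    by_contra! hcon
    have hsub : convexHull ℝ (p '' Set.Ici j) ⊆
        {v : V × E | inner ℝ g v.2 < ‖g‖ ^ 2 - 1 / ((n : ℝ) + 1)} := by
      refine convexHull_min ?_ ?_
      · rintro _ ⟨k, hk, rfl⟩
        exact hcon k (hnj.trans hk)
      · exact convex_halfSpace_lt ⟨fun a b => by simp [inner_add_right],
          fun c a => by simp [inner_smul_right]⟩ _
    exact lt_asymm hj (hsub (hq j))
  choose φ hφ hφi using hex
  refine ⟨φ, hφ, ?_⟩
  rw [tendsto_iff_norm_sub_tendsto_zero]
  have hφt : Tendsto φ atTop atTop := tendsto_atTop_mono hφ tendsto_id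
  -- Expanding `‖p - g‖² = ‖p‖² - 2⟨g, p⟩ + ‖g‖²` with the upper bound on the norm and the lower
  -- bound on the inner product gives the expression under the root.
  have h3 : Tendsto (fun n : ℕ =>
      √((‖g‖ + b (φ n)) ^ 2 - 2 * (‖g‖ ^ 2 - 1 / ((n : ℝ) + 1)) + ‖g‖ ^ 2))
      atTop (𝓝 √((‖g‖ + 0) ^ 2 - 2 * (‖g‖ ^ 2 - 0) + ‖g‖ ^ 2)) :=
    (Real.continuous_sqrt.tendsto _).comp (((((hb.comp hφt).const_add _).pow 2).sub
      ((tendsto_one_div_add_atTop_nhds_zero_nat.const_sub _).const_mul 2)).add_const _)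
  have h4 : (‖g‖ + 0) ^ 2 - 2 * (‖g‖ ^ 2 - 0) + ‖g‖ ^ 2 = 0 := by ring
  rw [h4, Real.sqrt_zero] at h3
  refine squeeze_zero (fun _ => norm_nonneg _) (fun n => ?_) h3
  apply Real.le_sqrt_of_sq_le
  rw [norm_sub_sq_real, real_inner_comm]
  have e3 := pow_le_pow_left₀ (norm_nonneg _) (hp (φ n)) 2
  have := hφi n
  linarith

end ForwardConvexCombinations

/-! ### Approximate slopes and convergence in measure -/

/-- A distance that metrizes convergence in measure for a finite measure `ν`. -/
noncomputable def l0dist {X : Type*} [MeasurableSpace X] (ν : Measure X) (f g : X → ℝ) : ℝ≥0∞ :=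
  ∫⁻ x, min 1 ‖f x - g x‖ₑ ∂ν

/-- The functions in `LIP_bd` whose asymptotic Lipschitz constant is at most `G` up to an error of
`L²(μ)`-norm at most `ε`. -/
def slopeBall {X : Type*} [MetricSpace X] [MeasurableSpace X] (μ : Measure X) (G : X → ℝ)
    (ε : ℝ≥0∞) : Set (X → ℝ) :=
  {h | LipBd h ∧ ∃ r, MemLp r 2 μ ∧ eLpNorm r 2 μ ≤ ε ∧ ∀ᵐ x ∂μ, lipAReal h x ≤ G x + r x}

/-- `f` is a limit, in the sense of convergence in measure for the finite measure `ν`, of functions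
in `LIP_bd` whose asymptotic Lipschitz constants are strongly bounded by `G` in `L²(μ)`. -/
def ApproxSlope {X : Type*} [MetricSpace X] [MeasurableSpace X] (ν μ : Measure X) (f G : X → ℝ) :
    Prop :=
  AEStronglyMeasurable f ν ∧ MemLp G 2 μ ∧
    ∀ ε : ℝ≥0∞, ε ≠ 0 → ∃ h ∈ slopeBall μ G ε, l0dist ν h f ≤ ε

section L0Distance

variable {X : Type*} [MeasurableSpace X] {ν : Measure X} {f g h : X → ℝ}

theorem l0dist_triangle (hg : AEStronglyMeasurable g ν) (hh : AEStronglyMeasurable h ν) :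
    l0dist ν f h ≤ l0dist ν f g + l0dist ν g h := by
  have hm : AEMeasurable (fun x => min 1 ‖g x - h x‖ₑ) ν :=
    aemeasurable_const.min (hg.sub hh).enorm
  rw [l0dist, l0dist, l0dist, ← lintegral_add_right' _ hm]
  refine lintegral_mono fun x => ?_
  have h1 : ‖f x - h x‖ₑ ≤ ‖f x - g x‖ₑ + ‖g x - h x‖ₑ := by
    have : f x - h x = (f x - g x) + (g x - h x) := by ring
    rw [this]
    exact enorm_add_le _ _
  rcases le_total 1 ‖f x - g x‖ₑ with h2 | h2
  · exact (min_le_left _ _).trans (by rw [min_eq_left h2]; exact le_self_add)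
  rcases le_total 1 ‖g x - h x‖ₑ with h3 | h3
  · exact (min_le_left _ _).trans (by rw [min_eq_left h3]; exact le_add_self)
  · rw [min_eq_right h2, min_eq_right h3]
    exact (min_le_right _ _).trans h1

theorem tendsto_l0dist [IsFiniteMeasure ν] {fn : ℕ → X → ℝ}
    (hfn : ∀ n, AEStronglyMeasurable (fn n) ν) (hf : AEStronglyMeasurable f ν)
    (hlim : ∀ᵐ x ∂ν, Tendsto (fun n => fn n x) atTop (𝓝 (f x))) :
    Tendsto (fun n => l0dist ν (fn n) f) atTop (𝓝 0) := by
  have h0 : (0 : ℝ≥0∞) = ∫⁻ _, 0 ∂ν := by simp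
  rw [h0]
  refine tendsto_lintegral_of_dominated_convergence' (fun _ => 1)
    (fun n => aemeasurable_const.min ((hfn n).sub hf).enorm)
    (fun n => ae_of_all _ fun x => min_le_left _ _) (by simp) ?_
  filter_upwards [hlim] with x hx
  have h1 : Tendsto (fun n => ‖fn n x - f x‖ₑ) atTop (𝓝 0) := by
    have := (hx.sub_const (f x)).enorm
    simpa using this
  have h2 := (tendsto_const_nhds (x := (1 : ℝ≥0∞))).min h1
  simpa using h2

theorem tendstoInMeasure_of_l0dist {fn : ℕ → X → ℝ}
    (hfn : ∀ n, AEStronglyMeasurable (fn n) ν) (hf : AEStronglyMeasurable f ν)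
    (hlim : Tendsto (fun n => l0dist ν (fn n) f) atTop (𝓝 0)) :
    TendstoInMeasure ν fn atTop f := by
  intro ε hε
  -- The integrand is cut off at `1`, so Chebyshev's inequality has to be applied at level `min 1
  -- ε`.
  set δ := min 1 ε with hδ
  have hδ0 : δ ≠ 0 := (lt_min one_pos hε).ne'
  have hδt : δ ≠ ∞ := (lt_of_le_of_lt (min_le_left _ _) ENNReal.one_lt_top).ne
  have h1 : Tendsto (fun n => l0dist ν (fn n) f / δ) atTop (𝓝 (0 / δ)) :=
    ENNReal.Tendsto.div_const hlim (Or.inr hδ0)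
  rw [ENNReal.zero_div] at h1
  refine tendsto_of_tendsto_of_tendsto_of_le_of_le tendsto_const_nhds h1 (fun _ => zero_le)
    fun n => ?_
  rw [ENNReal.le_div_iff_mul_le (Or.inl hδ0) (Or.inl hδt), mul_comm]
  refine le_trans ?_ (mul_meas_ge_le_lintegral₀
    (aemeasurable_const.min ((hfn n).sub hf).enorm) δ)
  refine mul_le_mul_right (measure_mono fun x hx => ?_) _
  rw [Set.mem_ofPred_eq, edist_eq_enorm_sub] at hx
  exact min_le_min le_rfl hx

end L0Distance

/-! ### Convergence to zero in `L²` -/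

section LTwo

variable {X : Type*} [MeasurableSpace X] {μ : Measure X} {G : X → ℝ}

theorem tendsto_eLpNorm_add {r s : ℕ → X → ℝ} (hr : ∀ n, MemLp (r n) 2 μ)
    (hs : ∀ n, MemLp (s n) 2 μ) (hr0 : Tendsto (fun n => eLpNorm (r n) 2 μ) atTop (𝓝 0))
    (hs0 : Tendsto (fun n => eLpNorm (s n) 2 μ) atTop (𝓝 0)) :
    Tendsto (fun n => eLpNorm (r n + s n) 2 μ) atTop (𝓝 0) := by
  have := hr0.add hs0
  rw [add_zero] at this
  exact tendsto_of_tendsto_of_tendsto_of_le_of_le tendsto_const_nhds this (fun _ => zero_le)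
    fun n => eLpNorm_add_le (hr n).1 (hs n).1 (by norm_num)

theorem eLpNorm_two_eq (h : X → ℝ) :
    eLpNorm h 2 μ = (∫⁻ x, ‖h x‖ₑ ^ (2 : ℝ) ∂μ) ^ (1 / 2 : ℝ) := by
  rw [eLpNorm_eq_lintegral_rpow_enorm_toReal (by norm_num) (by norm_num)]; simp

/-- Dominated convergence to `0` in `L²`. -/
theorem tendsto_eLpNorm_zero_of_dominated {F : ℕ → X → ℝ} (hG : MemLp G 2 μ)
    (hF : ∀ n, AEStronglyMeasurable (F n) μ) (hle : ∀ n, ∀ᵐ x ∂μ, ‖F n x‖ ≤ G x)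
    (hlim : ∀ᵐ x ∂μ, Tendsto (fun n => F n x) atTop (𝓝 0)) :
    Tendsto (fun n => eLpNorm (F n) 2 μ) atTop (𝓝 0) := by
  have h2 : Tendsto (fun n => ∫⁻ x, ‖F n x‖ₑ ^ (2 : ℝ) ∂μ) atTop (𝓝 (∫⁻ _, 0 ∂μ)) := by
    refine tendsto_lintegral_of_dominated_convergence' (fun x => ‖G x‖ₑ ^ (2 : ℝ))
      (fun n => (hF n).enorm.pow_const _) (fun n => ?_) ?_ ?_
    · filter_upwards [hle n] with x hx
      gcongr
      rw [enorm_le_iff_norm_le]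
      exact hx.trans (le_abs_self _)
    · have := lintegral_rpow_enorm_lt_top_of_eLpNorm_lt_top (by norm_num) (by norm_num) hG.2
      simpa using this.ne
    · filter_upwards [hlim] with x hx
      have h3 : Tendsto (fun n => ‖F n x‖ₑ) atTop (𝓝 0) := by simpa using hx.enorm
      have h4 := (ENNReal.continuous_rpow_const (y := (2 : ℝ))).tendsto 0
      rw [ENNReal.zero_rpow_of_pos (by norm_num)] at h4
      exact h4.comp h3
  simp only [eLpNorm_two_eq]
  rw [lintegral_zero] at h2
  have h5 := (ENNReal.continuous_rpow_const (y := (1 / 2 : ℝ))).tendsto 0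
  rw [ENNReal.zero_rpow_of_pos (by norm_num)] at h5
  exact h5.comp h2

end LTwo

/-! ### Stability of approximate slopes -/

section ApproximateSlopes

variable {X : Type*} [MetricSpace X] [MeasurableSpace X] {ν μ : Measure X} {f g G G' : X → ℝ}

/-- This is convexity of `f ↦ lip_a f` together with convexity of balls in `L²(μ)`; it lets averaged
sequences keep their slope bound. -/
theorem convex_slopeBall (ε : ℝ≥0∞) : Convex ℝ (slopeBall μ G ε) := by
  rintro h ⟨hh, r, hr, hrε, hle⟩ h' ⟨hh', r', hr', hrε', hle'⟩ a b ha hb hab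
  refine ⟨hh.combo ha hb hh', a • r + b • r', (hr.const_smul a).add (hr'.const_smul b), ?_, ?_⟩
  · refine (eLpNorm_add_le (hr.const_smul a).1 (hr'.const_smul b).1 (by norm_num)).trans ?_
    rw [eLpNorm_const_smul, eLpNorm_const_smul]
    calc ‖a‖ₑ * eLpNorm r 2 μ + ‖b‖ₑ * eLpNorm r' 2 μ ≤ ‖a‖ₑ * ε + ‖b‖ₑ * ε := by gcongr
      _ = (‖a‖ₑ + ‖b‖ₑ) * ε := (add_mul _ _ _).symm
      _ = ε := by
        rw [Real.enorm_of_nonneg ha, Real.enorm_of_nonneg hb, ← ENNReal.ofReal_add ha hb, hab]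
        simp
  · filter_upwards [hle, hle'] with x h1 h2
    have h3 := mul_le_mul_of_nonneg_left h1 ha
    have h4 := mul_le_mul_of_nonneg_left h2 hb
    have h5 := lipAReal_combo_le ha hb hh hh' x
    have h6 : G x = a * G x + b * G x := by rw [← add_mul, hab, one_mul]
    change lipAReal (fun y => a * h y + b * h' y) x ≤ G x + (a * r x + b * r' x)
    linarith

theorem slopeBall_comp {ε : ℝ≥0∞} {φ : ℝ → ℝ} (hφ : ∀ s t, |φ s - φ t| ≤ |s - t|)
    (hf : f ∈ slopeBall μ G ε) : (fun x => φ (f x)) ∈ slopeBall μ G ε := by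
  obtain ⟨hf, r, hr, hrε, hle⟩ := hf
  refine ⟨hf.comp hφ, r, hr, hrε, ?_⟩
  filter_upwards [hle] with x hx
  exact (lipAReal_comp_le hφ hf x).trans hx

/-- A sequence in `LIP_bd` with asymptotic Lipschitz constants bounded by `G + r n`, where
`r n → 0` in `L²(μ)`. -/
structure SlopeSeq (μ : Measure X) (G : X → ℝ) (h r : ℕ → X → ℝ) : Prop where
  lipBd : ∀ n, LipBd (h n)
  memLp : ∀ n, MemLp (r n) 2 μ
  tendsto : Tendsto (fun n => eLpNorm (r n) 2 μ) atTop (𝓝 0)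
  le : ∀ n, ∀ᵐ x ∂μ, lipAReal (h n) x ≤ G x + r n x

theorem SlopeSeq.comp {h r : ℕ → X → ℝ} (H : SlopeSeq μ G h r) {φ : ℕ → ℕ}
    (hφ : Tendsto φ atTop atTop) : SlopeSeq μ G (fun n => h (φ n)) (fun n => r (φ n)) :=
  ⟨fun _ => H.lipBd _, fun _ => H.memLp _, H.tendsto.comp hφ, fun _ => H.le _⟩

/-- Half of `ε` is spent on approximating `f` by some `fn n`, half on approximating `fn n` by
`LIP_bd`. As the definition asks for one approximant per `ε`, this replaces all diagonal sequences,
and most later constructions end here. -/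
theorem ApproxSlope.of_tendsto [IsFiniteMeasure ν] {fn Gn r : ℕ → X → ℝ}
    (hfn : ∀ n, ApproxSlope ν μ (fn n) (Gn n)) (hG : MemLp G 2 μ) (hr : ∀ n, MemLp (r n) 2 μ)
    (hr0 : Tendsto (fun n => eLpNorm (r n) 2 μ) atTop (𝓝 0))
    (hle : ∀ n, ∀ᵐ x ∂μ, Gn n x ≤ G x + r n x)
    (hf : ∀ᵐ x ∂ν, Tendsto (fun n => fn n x) atTop (𝓝 (f x))) : ApproxSlope ν μ f G := by
  have hfm : AEStronglyMeasurable f ν :=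
    aestronglyMeasurable_of_tendsto_ae atTop (fun n => (hfn n).1) hf
  refine ⟨hfm, hG, fun ε hε => ?_⟩
  have hε2 : 0 < ε / 2 := ENNReal.half_pos hε
  obtain ⟨n, hn1, hn2⟩ := ((hr0.eventually (ge_mem_nhds hε2)).and
    ((tendsto_l0dist (fun n => (hfn n).1) hfm hf).eventually (ge_mem_nhds hε2))).exists
  obtain ⟨h, ⟨hh, s, hs, hsε, hsle⟩, hd⟩ := (hfn n).2.2 (ε / 2) hε2.ne'
  refine ⟨h, ⟨hh, s + r n, hs.add (hr n), ?_, ?_⟩, ?_⟩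
  · refine (eLpNorm_add_le hs.1 (hr n).1 (by norm_num)).trans ?_
    exact (add_le_add hsε hn1).trans_eq (ENNReal.add_halves ε)
  · filter_upwards [hsle, hle n] with x h1 h2
    simp only [Pi.add_apply]
    linarith
  · exact ((l0dist_triangle (hfn n).1 hfm).trans (add_le_add hd hn2)).trans_eq
      (ENNReal.add_halves ε)

theorem ApproxSlope.mono [IsFiniteMeasure ν] (H : ApproxSlope ν μ f G) (hG' : MemLp G' 2 μ)
    (hle : G ≤ᵐ[μ] G') : ApproxSlope ν μ f G' :=
  .of_tendsto (r := fun _ => 0) (fun _ => H) hG' (fun _ => MemLp.zero) (by simp)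
    (fun _ => by filter_upwards [hle] with x hx; simpa using hx)
    (ae_of_all _ fun _ => tendsto_const_nhds)

theorem ApproxSlope.congr [IsFiniteMeasure ν] (H : ApproxSlope ν μ f G) (hfg : f =ᵐ[ν] g) :
    ApproxSlope ν μ g G :=
  .of_tendsto (r := fun _ => 0) (fun _ => H) H.2.1 (fun _ => MemLp.zero) (by simp)
    (fun _ => by simp) (by filter_upwards [hfg] with x hx; rw [hx]; exact tendsto_const_nhds)

variable [BorelSpace X]

theorem LipBd.aestronglyMeasurable (hf : LipBd f) : AEStronglyMeasurable f ν :=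
  hf.continuous.measurable.aestronglyMeasurable

theorem LipBd.approxSlope (hf : LipBd f) (hG : MemLp G 2 μ) (hle : lipAReal f ≤ᵐ[μ] G) :
    ApproxSlope ν μ f G := by
  refine ⟨hf.aestronglyMeasurable, hG, fun ε _ => ⟨f, ⟨hf, 0, by simp, by simp, ?_⟩, ?_⟩⟩
  · filter_upwards [hle] with x hx
    simpa using hx
  · simp [l0dist]

theorem LipBd.memLp_lipAReal (hf : LipBd f) (hG : MemLp G 2 μ) (hle : lipAReal f ≤ᵐ[μ] G) :
    MemLp (lipAReal f) 2 μ := by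
  refine hG.mono hf.measurable_lipAReal.aestronglyMeasurable ?_
  filter_upwards [hle] with x hx
  rw [Real.norm_of_nonneg (lipAReal_nonneg _ _)]
  exact hx.trans (le_abs_self _)

theorem SlopeSeq.approxSlope [IsFiniteMeasure ν] {h r : ℕ → X → ℝ} (H : SlopeSeq μ G h r)
    (hG : MemLp G 2 μ) (hf : ∀ᵐ x ∂ν, Tendsto (fun n => h n x) atTop (𝓝 (f x))) :
    ApproxSlope ν μ f G :=
  .of_tendsto (fun n => (H.lipBd n).approxSlope (hG.add (H.memLp n)) (H.le n)) hG H.memLp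
    H.tendsto (fun _ => ae_of_all _ fun _ => le_rfl) hf

/-- Approximants for `ε = 1/(n+1)` converge in measure, and their errors in `L²`; two extractions of
subsequences make both converge almost everywhere. -/
theorem ApproxSlope.exists_seq (H : ApproxSlope ν μ f G) :
    ∃ h r : ℕ → X → ℝ, SlopeSeq μ G h r ∧ (∀ᵐ x ∂ν, Tendsto (fun n => h n x) atTop (𝓝 (f x))) ∧
      ∀ᵐ x ∂μ, Tendsto (fun n => r n x) atTop (𝓝 0) := by
  have hex : ∀ n : ℕ, ∃ h ∈ slopeBall μ G ((n : ℝ≥0∞) + 1)⁻¹, l0dist ν h f ≤ ((n : ℝ≥0∞) + 1)⁻¹ :=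
    fun n => H.2.2 _ (by simp)
  have hlim : Tendsto (fun n : ℕ => ((n : ℝ≥0∞) + 1)⁻¹) atTop (𝓝 0) := by
    have := (tendsto_add_atTop_iff_nat 1).2 ENNReal.tendsto_inv_nat_nhds_zero
    simpa using this
  choose h hh hd using hex
  choose hb r hr hrε hle using hh
  have hd0 := tendsto_of_tendsto_of_tendsto_of_le_of_le tendsto_const_nhds hlim
    (fun _ => zero_le) hd
  have hr0 := tendsto_of_tendsto_of_tendsto_of_le_of_le tendsto_const_nhds hlim
    (fun _ => zero_le) hrε
  obtain ⟨φ, hφ, h1⟩ := (tendstoInMeasure_of_l0dist (fun n => (hb n).aestronglyMeasurable) H.1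
    hd0).exists_seq_tendsto_ae
  have hr1 : Tendsto (fun n => eLpNorm (r (φ n) - 0) 2 μ) atTop (𝓝 0) := by
    simpa [Function.comp_def] using hr0.comp hφ.tendsto_atTop
  obtain ⟨ψ, hψ, h2⟩ := (tendstoInMeasure_of_tendsto_eLpNorm (by norm_num)
    (fun n => (hr (φ n)).1) aestronglyMeasurable_zero hr1).exists_seq_tendsto_ae
  have hS : SlopeSeq μ G h r := ⟨hb, hr, hr0, hle⟩
  refine ⟨_, _, hS.comp (hφ.tendsto_atTop.comp hψ.tendsto_atTop), ?_, h2⟩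
  filter_upwards [h1] with x hx
  exact hx.comp hψ.tendsto_atTop

theorem ApproxSlope.nonneg (H : ApproxSlope ν μ f G) : 0 ≤ᵐ[μ] G := by
  obtain ⟨h, r, hS, -, hr⟩ := H.exists_seq
  filter_upwards [hr, ae_all_iff.2 hS.le] with x hx hle
  have h1 := hx.const_add (G x)
  rw [add_zero] at h1
  exact ge_of_tendsto' h1 fun n => (lipAReal_nonneg _ _).trans (hle n)

theorem ApproxSlope.comp [IsFiniteMeasure ν] {φ : ℝ → ℝ}
    (hφ : ∀ s t, |φ s - φ t| ≤ |s - t|) (H : ApproxSlope ν μ f G) :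
    ApproxSlope ν μ (fun x => φ (f x)) G := by
  obtain ⟨h, r, hS, hlim, -⟩ := H.exists_seq
  have hφc : Continuous φ := (LipschitzWith.of_dist_le_mul (K := 1) fun s t => by
    simpa [Real.dist_eq] using hφ s t).continuous
  refine SlopeSeq.approxSlope (h := fun n x => φ (h n x)) (r := r)
    ⟨fun n => (hS.lipBd n).comp hφ, hS.memLp, hS.tendsto, fun n => ?_⟩ H.2.1 ?_
  · filter_upwards [hS.le n] with x hx
    exact (lipAReal_comp_le hφ (hS.lipBd n) x).trans hx
  · filter_upwards [hlim] with x hx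
    exact (hφc.tendsto _).comp hx

theorem ApproxSlope.add [IsFiniteMeasure ν] (H : ApproxSlope ν μ f G)
    (H' : ApproxSlope ν μ g G') : ApproxSlope ν μ (fun x => f x + g x) (G + G') := by
  obtain ⟨h, r, hS, hlim, -⟩ := H.exists_seq
  obtain ⟨h', r', hS', hlim', -⟩ := H'.exists_seq
  refine SlopeSeq.approxSlope (h := fun n x => h n x + h' n x) (r := fun n => r n + r' n)
    ⟨fun n => ?_, fun n => (hS.memLp n).add (hS'.memLp n),
      tendsto_eLpNorm_add hS.memLp hS'.memLp hS.tendsto hS'.tendsto, fun n => ?_⟩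
    (H.2.1.add H'.2.1) ?_
  · simpa using (hS.lipBd n).combo zero_le_one zero_le_one (hS'.lipBd n)
  · filter_upwards [hS.le n, hS'.le n] with x hx hx'
    have := lipAReal_combo_le zero_le_one zero_le_one (hS.lipBd n) (hS'.lipBd n) x
    simp only [one_mul] at this
    simp only [Pi.add_apply]
    linarith
  · filter_upwards [hlim, hlim'] with x hx hx'
    exact hx.add hx'

end ApproximateSlopes

/-! ### Existence of least elements -/

/-- A family of nonnegative functions in `L²` that is stable under minima and limits in `L²` has a
least element. -/
theorem exists_isLeastAE {X : Type*} [MeasurableSpace X] {μ : Measure X} {S : Set (X → ℝ)}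
    (hne : S.Nonempty) (hmem : ∀ G ∈ S, MemLp G 2 μ) (h0 : ∀ G ∈ S, 0 ≤ᵐ[μ] G)
    (hmin : ∀ G ∈ S, ∀ G' ∈ S, (fun x => min (G x) (G' x)) ∈ S)
    (hlim : ∀ (Gn : ℕ → X → ℝ) (G : X → ℝ), (∀ n, Gn n ∈ S) → MemLp G 2 μ →
      Tendsto (fun n => eLpNorm (fun x => Gn n x - G x) 2 μ) atTop (𝓝 0) → G ∈ S) :
    ∃ G, IsLeastAE μ S G := by
  set J : (X → ℝ) → ℝ := fun G => ∫ x, G x ^ 2 ∂μ with hJ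
  have hJ0 : ∀ G, 0 ≤ J G := fun G => integral_nonneg fun x => sq_nonneg _
  have hJmono : ∀ G ∈ S, ∀ G' ∈ S, G ≤ᵐ[μ] G' → J G ≤ J G' := by
    intro G hG G' hG' hle
    refine integral_mono_ae (hmem G hG).integrable_sq (hmem G' hG').integrable_sq ?_
    filter_upwards [hle, h0 G hG] with x hx hx0
    exact pow_le_pow_left₀ hx0 hx 2
  have hbdd : BddBelow (J '' S) := ⟨0, by rintro _ ⟨G, -, rfl⟩; exact hJ0 G⟩
  set d := sInf (J '' S)
  have hd : ∀ G ∈ S, d ≤ J G := fun G hG => csInf_le hbdd ⟨G, hG, rfl⟩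
  have hex : ∀ n : ℕ, ∃ G ∈ S, J G < d + 1 / ((n : ℝ) + 1) := by
    intro n
    obtain ⟨_, ⟨v, hv, rfl⟩, h⟩ := exists_lt_of_csInf_lt (hne.image J)
      (show sInf (J '' S) < d + 1 / ((n : ℝ) + 1) from lt_add_of_pos_right _ (by positivity))
    exact ⟨v, hv, h⟩
  choose v hv hvJ using hex
  -- Running minima of a minimizing sequence for `J` stay in `S` and decrease, so they converge
  -- pointwise and, being dominated by `w 0`, in `L²`.
  let w : ℕ → X → ℝ := fun n => Nat.rec (v 0) (fun k g x => min (g x) (v (k + 1) x)) n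
  have hwS : ∀ n, w n ∈ S := by
    intro n
    induction n with
    | zero => exact hv 0
    | succ k ih => exact hmin _ ih _ (hv (k + 1))
  have hwv : ∀ n x, w n x ≤ v n x := by
    intro n x
    cases n with
    | zero => exact le_rfl
    | succ k => exact min_le_right _ _
  have hanti : ∀ x, Antitone fun n => w n x := fun x =>
    antitone_nat_of_succ_le fun n => min_le_left _ _
  have hw0 : ∀ᵐ x ∂μ, ∀ n, 0 ≤ w n x := ae_all_iff.2 fun n => h0 _ (hwS n)
  set G : X → ℝ := fun x => ⨅ n, w n x
  have hwG : ∀ᵐ x ∂μ, Tendsto (fun n => w n x) atTop (𝓝 (G x)) := by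
    filter_upwards [hw0] with x hx
    exact tendsto_atTop_ciInf (hanti x) ⟨0, by rintro _ ⟨n, rfl⟩; exact hx n⟩
  have hGw : ∀ᵐ x ∂μ, 0 ≤ G x ∧ ∀ n, G x ≤ w n x := by
    filter_upwards [hw0] with x hx
    exact ⟨le_ciInf hx, fun n => ciInf_le ⟨0, by rintro _ ⟨n, rfl⟩; exact hx n⟩ n⟩
  have hGm : AEStronglyMeasurable G μ :=
    aestronglyMeasurable_of_tendsto_ae atTop (fun n => (hmem _ (hwS n)).1) hwG
  have hGmem : MemLp G 2 μ := by
    refine (hmem _ (hwS 0)).mono hGm ?_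
    filter_upwards [hGw, hw0] with x hx hx0
    rw [Real.norm_of_nonneg hx.1, Real.norm_of_nonneg (hx0 0)]
    exact hx.2 0
  have hGS : G ∈ S := by
    refine hlim w G hwS hGmem (tendsto_eLpNorm_zero_of_dominated (hmem _ (hwS 0))
      (fun n => (hmem _ (hwS n)).1.sub hGm) (fun n => ?_) ?_)
    · filter_upwards [hGw] with x hx
      rw [Real.norm_of_nonneg (sub_nonneg.2 (hx.2 n))]
      have := hanti x (Nat.zero_le n)
      simp only at this
      linarith [hx.1]
    · filter_upwards [hwG] with x hx
      simpa using hx.sub_const (G x)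
  have hJG : J G ≤ d := by
    refine ge_of_tendsto' (f := fun n : ℕ => d + 1 / ((n : ℝ) + 1)) (x := atTop) ?_ fun n => ?_
    · simpa using tendsto_one_div_add_atTop_nhds_zero_nat.const_add d
    · refine le_trans (hJmono G hGS _ (hv n) ?_) (hvJ n).le
      filter_upwards [hGw] with x hx
      exact (hx.2 n).trans (hwv n x)
  refine ⟨G, hGS, fun G' hG' => ?_⟩
  -- Since `G` minimizes `J`, its minimum `m` with any competitor has the same `J`; as `0 ≤ m ≤ G`,
  -- the two coincide almost everywhere.
  have hmS := hmin G hGS G' hG'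
  set m : X → ℝ := fun x => min (G x) (G' x)
  have h1 : J G - J m ≤ 0 := by linarith [hd m hmS]
  have hi : Integrable (fun x => G x ^ 2 - m x ^ 2) μ :=
    hGmem.integrable_sq.sub (hmem m hmS).integrable_sq
  have hpos : 0 ≤ᵐ[μ] fun x => G x ^ 2 - m x ^ 2 := by
    filter_upwards [h0 _ hmS] with x hx
    exact sub_nonneg.2 (pow_le_pow_left₀ hx (min_le_left _ _) 2)
  have h2 : ∫ x, (G x ^ 2 - m x ^ 2) ∂μ = J G - J m :=
    integral_sub hGmem.integrable_sq (hmem m hmS).integrable_sq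
  have h3 : ∫ x, (G x ^ 2 - m x ^ 2) ∂μ = 0 :=
    le_antisymm (h2 ▸ h1) (integral_nonneg_of_ae hpos)
  filter_upwards [(integral_eq_zero_iff_of_nonneg_ae hpos hi).1 h3, h0 _ hmS] with x hx hx0
  have h4 : G x ^ 2 = m x ^ 2 := sub_eq_zero.1 hx
  have h5 : 0 ≤ m x := hx0
  have h6 : G x ≤ m x := by
    by_contra h
    nlinarith [not_le.1 h]
  exact h6.trans (min_le_right _ _)

/-! ### Vanishing of slopes on zero sets -/

section Locality

variable {X : Type*} [MetricSpace X] [MeasurableSpace X] [BorelSpace X] {ν μ : Measure X}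
  {f g G G' : X → ℝ}

/-- Soft thresholding at level `ε`: a `1`-Lipschitz function vanishing on `[-ε, ε]`. -/
def softThreshold (ε t : ℝ) : ℝ := max (t - ε) (min (t + ε) 0)

theorem softThreshold_lipschitz (ε s t : ℝ) :
    |softThreshold ε s - softThreshold ε t| ≤ |s - t| := by
  refine (abs_max_sub_max_le_max _ _ _ _).trans (max_le (by simp) ?_)
  refine (abs_min_sub_min_le_max _ _ _ _).trans (max_le (by simp) (by simp))

theorem softThreshold_eq_zero {ε t : ℝ} (h : |t| ≤ ε) : softThreshold ε t = 0 := by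
  obtain ⟨h1, h2⟩ := abs_le.1 h
  rw [softThreshold, min_eq_right (by linarith), max_eq_right (by linarith)]

theorem softThreshold_sub_le {ε : ℝ} (hε : 0 ≤ ε) (t : ℝ) : |softThreshold ε t - t| ≤ ε := by
  rw [softThreshold, abs_le]
  constructor
  · linarith [le_max_left (t - ε) (min (t + ε) 0)]
  · have : max (t - ε) (min (t + ε) 0) ≤ t + ε := max_le (by linarith) (min_le_left _ _)
    linarith

/-- Slopes may be replaced by `0` on the zero set of the function. -/
theorem ApproxSlope.indicator [IsFiniteMeasure ν] (hμν : μ ≪ ν) (H : ApproxSlope ν μ f G)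
    {E : Set X} (hE : MeasurableSet E) (hf : ∀ᵐ x ∂μ, x ∉ E → f x = 0) :
    ApproxSlope ν μ f (E.indicator G) := by
  obtain ⟨h, r, hS, hlim, -⟩ := H.exists_seq
  have hG0 := H.nonneg
  -- Where `f = 0`, eventually `|h n| < ε`, and then the thresholded `h n` vanishes near the point
  -- by continuity and has slope `0`. The exceptional points off `E` form the sets `A n`, on which
  -- `G` tends to `0` in `L²` by dominated convergence. Finally `ε → 0`.
  have key : ∀ ε : ℝ, 0 < ε →
      ApproxSlope ν μ (fun x => softThreshold ε (f x)) (E.indicator G) := by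
    intro ε hε
    set A : ℕ → Set X := fun n => Eᶜ ∩ {x | ε ≤ |h n x|}
    have hA : ∀ n, MeasurableSet (A n) := fun n => hE.compl.inter
      (measurableSet_le measurable_const (hS.lipBd n).continuous.measurable.abs)
    have hAG : ∀ n, MemLp ((A n).indicator G) 2 μ := fun n => H.2.1.indicator (hA n)
    refine SlopeSeq.approxSlope (h := fun n x => softThreshold ε (h n x))
      (r := fun n => (A n).indicator G + fun x => ‖r n x‖)
      ⟨fun n => (hS.lipBd n).comp (softThreshold_lipschitz ε), fun n => (hAG n).add
        (hS.memLp n).norm, tendsto_eLpNorm_add hAG (fun n => (hS.memLp n).norm) ?_ ?_, fun n => ?_⟩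
      (H.2.1.indicator hE) ?_
    · refine tendsto_eLpNorm_zero_of_dominated H.2.1 (fun n => (hAG n).1) (fun n => ?_) ?_
      · filter_upwards [hG0] with x hx
        exact (norm_indicator_le_norm_self G x).trans (Real.norm_of_nonneg hx).le
      · filter_upwards [hf, hμν.ae_le hlim] with x hx hxl
        by_cases hxE : x ∈ E
        · simp [A, hxE]
        · rw [hx hxE] at hxl
          have h1 : ∀ᶠ n in atTop, |h n x| < ε := by
            have := hxl.abs
            rw [abs_zero] at this
            exact this.eventually (gt_mem_nhds hε)
          refine tendsto_const_nhds.congr' ?_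
          filter_upwards [h1] with n hn
          simp [A, hn]
    · simpa only [eLpNorm_norm] using hS.tendsto
    · filter_upwards [hS.le n, hG0] with x hx hx0
      have hr := le_abs_self (r n x)
      simp only [Pi.add_apply, Real.norm_eq_abs]
      change 0 ≤ G x at hx0
      by_cases hxε : ε ≤ |h n x|
      · have h2 := lipAReal_comp_le (softThreshold_lipschitz ε) (hS.lipBd n) x
        by_cases hxE : x ∈ E
        · have h3 : 0 ≤ (A n).indicator G x := Set.indicator_apply_nonneg fun _ => hx0
          rw [Set.indicator_of_mem hxE]
          linarith
        · rw [Set.indicator_of_notMem hxE, Set.indicator_of_mem (show x ∈ A n from ⟨hxE, hxε⟩)]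
          linarith
      · have h3 : 0 ≤ (A n).indicator G x := Set.indicator_apply_nonneg fun _ => hx0
        have h4 : 0 ≤ E.indicator G x := Set.indicator_apply_nonneg fun _ => hx0
        have h5 : lipAReal (fun y => softThreshold ε (h n y)) x ≤ 0 := by
          refine lipAReal_const_near 0 ?_
          filter_upwards [(hS.lipBd n).continuous.abs.continuousAt.eventually
            (gt_mem_nhds (not_le.1 hxε))] with y hy
          exact softThreshold_eq_zero hy.le
        have := abs_nonneg (r n x)
        linarith
    · filter_upwards [hlim] with x hx
      have hc : Continuous (softThreshold ε) := by unfold softThreshold; fun_prop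
      exact (hc.tendsto _).comp hx
  refine ApproxSlope.of_tendsto (fun n : ℕ => key (1 / ((n : ℝ) + 1)) (by positivity))
    (H.2.1.indicator hE) (r := fun _ => 0) (fun _ => MemLp.zero) (by simp) (fun _ => by simp)
    (ae_of_all _ fun x => ?_)
  rw [tendsto_iff_norm_sub_tendsto_zero]
  exact squeeze_zero (fun _ => norm_nonneg _)
    (fun n => softThreshold_sub_le (by positivity) (f x)) tendsto_one_div_add_atTop_nhds_zero_nat

end Locality

/-! ### Gluing slopes along Borel sets -/

/-- A Lipschitz bump of height `δ ^ 2` on `F` and Lipschitz constant `δ`, vanishing at distance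
at least `δ` from `F`. -/
noncomputable def bump {X : Type*} [MetricSpace X] (F : Set X) (δ : ℝ) (x : X) : ℝ :=
  δ * max (δ - Metric.infDist x F) 0

theorem lipschitz_bump {X : Type*} [MetricSpace X] (F : Set X) {δ : ℝ} (hδ : 0 ≤ δ) :
    LipschitzWith δ.toNNReal (bump F δ) := by
  refine LipschitzWith.of_dist_le_mul fun x y => ?_
  rw [Real.coe_toNNReal _ hδ, Real.dist_eq, bump, bump, ← mul_sub, abs_mul, abs_of_nonneg hδ]
  refine mul_le_mul_of_nonneg_left ?_ hδ
  refine (abs_max_sub_max_le_abs _ _ _).trans ?_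
  have := (Metric.lipschitz_infDist_pt F).dist_le_mul y x
  rw [Real.dist_eq, NNReal.coe_one, one_mul, dist_comm] at this
  refine le_trans (le_of_eq ?_) this
  congr 1; ring

section Gluing

variable {X : Type*} [MetricSpace X] [MeasurableSpace X] [BorelSpace X] {ν μ : Measure X}
  {f g G G' : X → ℝ}

/-- Two approximations `a n` (slope `G`) and `b n` (slope `G'`) of the same `f` are merged by
clamping `b n` to `[a n - θ, a n + θ]`. On `F` the bump `θ` has height `δ²` and the clamp is
inactive once `|b n - a n| < δ²`; beyond distance `δ` it forces the value `a n`. In the collar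
between, both slopes and the constant `δ` of `θ` are paid. -/
theorem ApproxSlope.glue_bump [IsFiniteMeasure ν]
    (hμ : ∀ B : Set X, Bornology.IsBounded B → μ B < ∞) (hμν : μ ≪ ν)
    (H : ApproxSlope ν μ f G) (H' : ApproxSlope ν μ f G') {F : Set X} (hF : IsClosed F)
    (hFb : Bornology.IsBounded {x | Metric.infDist x F ≤ 1}) (hFne : F.Nonempty)
    {δ : ℝ} (hδ : 0 < δ) (hδ1 : δ ≤ 1) :
    ApproxSlope ν μ f (F.indicator G' + Fᶜ.indicator G +
      ({x | 0 < Metric.infDist x F ∧ Metric.infDist x F ≤ δ}.indicator (G + G') +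
        {x | Metric.infDist x F ≤ δ}.indicator fun _ => δ)) := by
  obtain ⟨a, r, hS, hlim, -⟩ := H.exists_seq
  obtain ⟨b, r', hS', hlim', -⟩ := H'.exists_seq
  have hG0 := H.nonneg
  have hG0' := H'.nonneg
  have hD : Measurable fun x => Metric.infDist x F := (Metric.continuous_infDist_pt F).measurable
  set A : Set X := {x | 0 < Metric.infDist x F ∧ Metric.infDist x F ≤ δ} with hAdef
  set B : Set X := {x | Metric.infDist x F ≤ δ} with hBdef
  have hA : MeasurableSet A :=
    (measurableSet_lt measurable_const hD).inter (measurableSet_le hD measurable_const)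
  have hB : MeasurableSet B := measurableSet_le hD measurable_const
  have hBfin : μ B ≠ ∞ := (hμ B (hFb.subset fun x hx => le_trans hx hδ1)).ne
  set θ := bump F δ with hθ
  have hθlip : LipBd θ := (lipschitz_bump F hδ.le).lipBd
  have hθle : ∀ x, lipAReal θ x ≤ δ := fun x => by
    simpa [Real.coe_toNNReal _ hδ.le] using (lipschitz_bump F hδ.le).lipAReal_le x
  have hθ0 : ∀ x, 0 ≤ θ x := fun x => mul_nonneg hδ.le (le_max_right _ _)
  -- The points of `F` where the clamp may still be active. Both sequences converge to `f`, so these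
  -- sets contribute an error tending to `0` in `L²(μ)`.
  set E : ℕ → Set X := fun n => F ∩ {x | δ ^ 2 ≤ |b n x - a n x|}
  have hE : ∀ n, MeasurableSet (E n) := fun n => hF.measurableSet.inter
    (measurableSet_le measurable_const
      ((hS'.lipBd n).continuous.measurable.sub (hS.lipBd n).continuous.measurable).abs)
  have hEG : ∀ n, MemLp ((E n).indicator (G + G')) 2 μ :=
    fun n => (H.2.1.add H'.2.1).indicator (hE n)
  have hplus : ∀ n, LipBd fun x => a n x + θ x := fun n => by
    simpa using (hS.lipBd n).combo zero_le_one zero_le_one hθlip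
  have hminus : ∀ n, LipBd fun x => a n x - θ x := fun n => by
    simpa [sub_eq_add_neg] using (hS.lipBd n).combo zero_le_one zero_le_one hθlip.neg
  have hplusle : ∀ n x, lipAReal (fun x => a n x + θ x) x ≤ lipAReal (a n) x + δ := fun n x => by
    have := lipAReal_combo_le zero_le_one zero_le_one (hS.lipBd n) hθlip x
    simp only [one_mul] at this
    linarith [hθle x]
  have hminusle : ∀ n x, lipAReal (fun x => a n x - θ x) x ≤ lipAReal (a n) x + δ := fun n x => by
    have h1 := lipAReal_combo_le zero_le_one zero_le_one (hS.lipBd n) hθlip.neg x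
    have h2 : lipAReal (fun x => -θ x) x ≤ lipAReal θ x :=
      lipAReal_comp_le (φ := fun t => -t)
        (fun s t => by rw [← abs_neg]; apply le_of_eq; congr 1; ring) hθlip x
    simp only [one_mul, ← sub_eq_add_neg] at h1
    linarith [hθle x]
  refine SlopeSeq.approxSlope
    (h := fun n x => max (min (b n x) (a n x + θ x)) (a n x - θ x))
    (r := fun n => ((fun x => ‖r n x‖) + fun x => ‖r' n x‖) + (E n).indicator (G + G'))
    ⟨fun n => ((hS'.lipBd n).min (hplus n)).max (hminus n),
      fun n => ((hS.memLp n).norm.add (hS'.memLp n).norm).add (hEG n), ?_, fun n => ?_⟩ ?_ ?_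
  · refine tendsto_eLpNorm_add (fun n => (hS.memLp n).norm.add (hS'.memLp n).norm) hEG
      (tendsto_eLpNorm_add (fun n => (hS.memLp n).norm) (fun n => (hS'.memLp n).norm) ?_ ?_) ?_
    · simpa only [eLpNorm_norm] using hS.tendsto
    · simpa only [eLpNorm_norm] using hS'.tendsto
    · refine tendsto_eLpNorm_zero_of_dominated (H.2.1.add H'.2.1) (fun n => (hEG n).1)
        (fun n => ?_) ?_
      · filter_upwards [hG0, hG0'] with x hx hx'
        exact (norm_indicator_le_norm_self _ x).trans (Real.norm_of_nonneg (add_nonneg hx hx')).le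
      · filter_upwards [hμν.ae_le hlim, hμν.ae_le hlim'] with x hx hx'
        have h1 : ∀ᶠ n in atTop, |b n x - a n x| < δ ^ 2 := by
          have := (hx'.sub hx).abs
          rw [sub_self, abs_zero] at this
          exact this.eventually (gt_mem_nhds (by positivity))
        refine tendsto_const_nhds.congr' ?_
        filter_upwards [h1] with n hn
        simp [E, hn]
  · filter_upwards [hS.le n, hS'.le n, hG0, hG0'] with x hx hx' hx0 hx0'
    change 0 ≤ G x at hx0
    change 0 ≤ G' x at hx0'
    have hr := le_abs_self (r n x)
    have hr' := le_abs_self (r' n x)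
    have hra := abs_nonneg (r n x)
    have hra' := abs_nonneg (r' n x)
    simp only [Pi.add_apply, Real.norm_eq_abs]
    have i1 : 0 ≤ F.indicator G' x := Set.indicator_apply_nonneg fun _ => hx0'
    have i2 : 0 ≤ Fᶜ.indicator G x := Set.indicator_apply_nonneg fun _ => hx0
    have i3 : 0 ≤ A.indicator (G + G') x := Set.indicator_apply_nonneg fun _ => add_nonneg hx0 hx0'
    have i4 : 0 ≤ B.indicator (fun _ => δ) x := Set.indicator_apply_nonneg fun _ => hδ.le
    have i5 : 0 ≤ (E n).indicator (G + G') x :=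
      Set.indicator_apply_nonneg fun _ => add_nonneg hx0 hx0'
    rcases lt_or_ge δ (Metric.infDist x F) with hxδ | hxδ
    · have h1 : lipAReal (fun x => max (min (b n x) (a n x + θ x)) (a n x - θ x)) x ≤
          lipAReal (a n) x := by
        refine lipAReal_congr (hS.lipBd n) ?_
        filter_upwards [(Metric.continuous_infDist_pt F).continuousAt.eventually
          (lt_mem_nhds hxδ)] with y hy
        have : θ y = 0 := by
          rw [hθ, bump, max_eq_right (by linarith), mul_zero]
        simp [this]
      have hxF : x ∉ F := fun h => by
        rw [Metric.infDist_zero_of_mem h] at hxδ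
        exact lt_asymm hδ hxδ
      have e1 : Fᶜ.indicator G x = G x := Set.indicator_of_mem (s := Fᶜ) hxF G
      linarith
    · have h1 : lipAReal (fun x => max (min (b n x) (a n x + θ x)) (a n x - θ x)) x ≤
          lipAReal (a n) x + lipAReal (b n) x + δ := by
        have l1 := lipAReal_nonneg (a n) x
        have l2 := lipAReal_nonneg (b n) x
        refine (lipAReal_max_le ((hS'.lipBd n).min (hplus n)) (hminus n) x).trans (max_le ?_ ?_)
        · refine (lipAReal_min_le (hS'.lipBd n) (hplus n) x).trans (max_le (by linarith) ?_)
          linarith [hplusle n x]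
        · linarith [hminusle n x]
      have e4 : B.indicator (fun _ => δ) x = δ := Set.indicator_of_mem (s := B) hxδ _
      by_cases hxF : x ∈ F
      · have e1 : F.indicator G' x = G' x := Set.indicator_of_mem hxF G'
        by_cases hxE : δ ^ 2 ≤ |b n x - a n x|
        · have e5 : (E n).indicator (G + G') x = G x + G' x :=
            Set.indicator_of_mem (s := E n) ⟨hxF, hxE⟩ _
          linarith
        · have h2 : lipAReal (fun x => max (min (b n x) (a n x + θ x)) (a n x - θ x)) x ≤
              lipAReal (b n) x := by
            refine lipAReal_congr (hS'.lipBd n) ?_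
            have hcont : Continuous fun y => θ y - |b n y - a n y| :=
              hθlip.continuous.sub ((hS'.lipBd n).continuous.sub (hS.lipBd n).continuous).abs
            have hpos : 0 < θ x - |b n x - a n x| := by
              have : θ x = δ ^ 2 := by
                rw [hθ, bump, Metric.infDist_zero_of_mem hxF, sub_zero, max_eq_left hδ.le, sq]
              linarith [not_le.1 hxE]
            -- The strict inequality `|b n - a n| < θ` persists near `x`, so the clamped function
            -- equals `b n` on a neighbourhood, as the slope requires.
            filter_upwards [hcont.continuousAt.eventually (lt_mem_nhds hpos)] with y hy
            have h3 := abs_le.1 (show |b n y - a n y| ≤ θ y by linarith)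
            rw [min_eq_left (by linarith), max_eq_left (by linarith)]
          linarith
      · have hxpos : 0 < Metric.infDist x F := (hF.notMem_iff_infDist_pos hFne).1 hxF
        have e3 : A.indicator (G + G') x = G x + G' x :=
          Set.indicator_of_mem (s := A) ⟨hxpos, hxδ⟩ _
        linarith
  · exact ((H'.2.1.indicator hF.measurableSet).add (H.2.1.indicator hF.measurableSet.compl)).add
      (((H.2.1.add H'.2.1).indicator hA).add (memLp_indicator_const 2 hB δ (Or.inr hBfin)))
  · filter_upwards [hlim, hlim'] with x hx hx'
    have := (hx'.min (hx.add_const (θ x))).max (hx.sub_const (θ x))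
    have h1 := hθ0 x
    rwa [min_eq_left (by linarith), max_eq_left (by linarith)] at this

/-- As `δ → 0` the collars shrink to the empty set, because points off the closed set `F` have
positive distance to it. Boundedness of `F` makes the constants `δ` on the neighbourhoods `B n`
square integrable. -/
theorem ApproxSlope.glue_isClosed [IsFiniteMeasure ν]
    (hμ : ∀ B : Set X, Bornology.IsBounded B → μ B < ∞) (hμν : μ ≪ ν)
    (H : ApproxSlope ν μ f G) (H' : ApproxSlope ν μ f G') {F : Set X} (hF : IsClosed F)
    (hFb : Bornology.IsBounded F) :
    ApproxSlope ν μ f (F.indicator G' + Fᶜ.indicator G) := by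
  rcases F.eq_empty_or_nonempty with rfl | hFne
  · have e : (∅ : Set X).indicator G' + (∅ : Set X)ᶜ.indicator G = G := by ext; simp
    rwa [e]
  have hG0 := H.nonneg
  have hG0' := H'.nonneg
  have hb1 : Bornology.IsBounded {x | Metric.infDist x F ≤ 1} := by
    refine (hFb.thickening (δ := 2)).subset fun x hx => ?_
    rw [Metric.mem_thickening_iff]
    exact (Metric.infDist_lt_iff hFne).1 (lt_of_le_of_lt hx one_lt_two)
  have hD : Measurable fun x => Metric.infDist x F := (Metric.continuous_infDist_pt F).measurable
  set δ : ℕ → ℝ := fun n => 1 / ((n : ℝ) + 1)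
  have hδ : ∀ n, 0 < δ n := fun n => by positivity
  have hδ1 : ∀ n, δ n ≤ 1 := fun n => by
    rw [div_le_one (by positivity)]
    linarith [Nat.cast_nonneg (α := ℝ) n]
  have hδ0 : Tendsto δ atTop (𝓝 0) := tendsto_one_div_add_atTop_nhds_zero_nat
  set A : ℕ → Set X := fun n => {x | 0 < Metric.infDist x F ∧ Metric.infDist x F ≤ δ n}
  set B : ℕ → Set X := fun n => {x | Metric.infDist x F ≤ δ n}
  have hA : ∀ n, MeasurableSet (A n) := fun n =>
    (measurableSet_lt measurable_const hD).inter (measurableSet_le hD measurable_const)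
  have hB : ∀ n, MeasurableSet (B n) := fun n => measurableSet_le hD measurable_const
  have hBfin : ∀ n, μ (B n) ≠ ∞ := fun n =>
    (hμ _ (hb1.subset fun x hx => le_trans hx (hδ1 n))).ne
  have hA2 : ∀ n, MemLp ((A n).indicator (G + G')) 2 μ :=
    fun n => (H.2.1.add H'.2.1).indicator (hA n)
  have hB2 : ∀ n, MemLp ((B n).indicator fun _ => δ n) 2 μ :=
    fun n => memLp_indicator_const 2 (hB n) _ (Or.inr (hBfin n))
  have hB1 : MemLp ({x | Metric.infDist x F ≤ 1}.indicator fun _ => (1 : ℝ)) 2 μ :=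
    memLp_indicator_const 2 (measurableSet_le hD measurable_const) _ (Or.inr (hμ _ hb1).ne)
  refine ApproxSlope.of_tendsto
    (fun n => H.glue_bump hμ hμν H' hF hb1 hFne (hδ n) (hδ1 n))
    ((H'.2.1.indicator hF.measurableSet).add (H.2.1.indicator hF.measurableSet.compl))
    (r := fun n => (A n).indicator (G + G') + (B n).indicator fun _ => δ n)
    (fun n => (hA2 n).add (hB2 n)) (tendsto_eLpNorm_add hA2 hB2 ?_ ?_)
    (fun n => ae_of_all _ fun x => le_rfl) (ae_of_all _ fun x => tendsto_const_nhds)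
  · refine tendsto_eLpNorm_zero_of_dominated (H.2.1.add H'.2.1) (fun n => (hA2 n).1)
      (fun n => ?_) (ae_of_all _ fun x => ?_)
    · filter_upwards [hG0, hG0'] with x hx hx'
      exact (norm_indicator_le_norm_self _ x).trans (Real.norm_of_nonneg (add_nonneg hx hx')).le
    · refine tendsto_const_nhds.congr' ?_
      by_cases hx : 0 < Metric.infDist x F
      · filter_upwards [hδ0.eventually (gt_mem_nhds hx)] with n hn
        exact (Set.indicator_of_notMem (fun h => absurd h.2 (not_le.2 hn)) _).symm
      · exact Eventually.of_forall fun n =>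
          (Set.indicator_of_notMem (fun h => hx h.1) _).symm
  · refine tendsto_eLpNorm_zero_of_dominated hB1 (fun n => (hB2 n).1)
      (fun n => ae_of_all _ fun x => ?_) (ae_of_all _ fun x => ?_)
    · by_cases hx : x ∈ B n
      · rw [Set.indicator_of_mem hx,
          Set.indicator_of_mem (show x ∈ {x | Metric.infDist x F ≤ 1} from le_trans hx (hδ1 n)),
          Real.norm_of_nonneg (hδ n).le]
        exact hδ1 n
      · rw [Set.indicator_of_notMem hx, norm_zero]
        exact Set.indicator_apply_nonneg fun _ => zero_le_one
    · refine squeeze_zero_norm (fun n => ?_) hδ0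
      exact (norm_indicator_le_norm_self _ x).trans (Real.norm_of_nonneg (hδ n).le).le

/-- Slopes of the same function may be glued along Borel sets, up to an error supported on the
difference of two Borel sets. -/
theorem ApproxSlope.glue_of_subset [IsFiniteMeasure ν] (H : ApproxSlope ν μ f G)
    (H' : ApproxSlope ν μ f G') {B : Set X} (hB : MeasurableSet B) {C : ℕ → Set X}
    (hC : ∀ n, MeasurableSet (C n)) (hCB : ∀ n, C n ⊆ B)
    (hglue : ∀ n, ApproxSlope ν μ f ((C n).indicator G' + (C n)ᶜ.indicator G))
    (h0 : Tendsto (fun n => eLpNorm ((B \ C n).indicator (G + G')) 2 μ) atTop (𝓝 0)) :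
    ApproxSlope ν μ f (B.indicator G' + Bᶜ.indicator G) := by
  refine ApproxSlope.of_tendsto hglue ((H'.2.1.indicator hB).add (H.2.1.indicator hB.compl))
    (fun n => (H.2.1.add H'.2.1).indicator (hB.diff (hC n))) h0 (fun n => ?_)
    (ae_of_all _ fun _ => tendsto_const_nhds)
  filter_upwards [H.nonneg, H'.nonneg] with x hx hx'
  change 0 ≤ G x at hx
  change 0 ≤ G' x at hx'
  have := hCB n
  by_cases hxB : x ∈ B
  · by_cases hxC : x ∈ C n
    · simp [hxB, hxC]
    · simp [hxB, hxC]
      linarith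
  · have hxC : x ∉ C n := fun h => hxB (hCB n h)
    simp [hxB, hxC]

/-- Bounded Borel sets are exhausted from inside by closed sets, up to small mass for the finite
measure `|G + G'|² μ`; general Borel sets are exhausted by their intersections with balls. -/
theorem ApproxSlope.glue [IsFiniteMeasure ν]
    (hμ : ∀ B : Set X, Bornology.IsBounded B → μ B < ∞) (hμν : μ ≪ ν)
    (H : ApproxSlope ν μ f G) (H' : ApproxSlope ν μ f G') {B : Set X} (hB : MeasurableSet B) :
    ApproxSlope ν μ f (B.indicator G' + Bᶜ.indicator G) := by
  have hsum := H.2.1.add H'.2.1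
  have key : ∀ C : Set X, MeasurableSet C → Bornology.IsBounded C →
      ApproxSlope ν μ f (C.indicator G' + Cᶜ.indicator G) := by
    intro C hC hCb
    set η := μ.withDensity fun x => ‖(G + G') x‖ₑ ^ (2 : ℝ)
    have hfin : ∫⁻ x, ‖(G + G') x‖ₑ ^ (2 : ℝ) ∂μ ≠ ∞ := by
      have := lintegral_rpow_enorm_lt_top_of_eLpNorm_lt_top (by norm_num) (by norm_num) hsum.2
      simpa using this.ne
    have : IsFiniteMeasure η := isFiniteMeasure_withDensity hfin
    have hex : ∀ n : ℕ, ∃ F ⊆ C, IsClosed F ∧ η (C \ F) < ((n : ℝ≥0∞) + 1)⁻¹ := by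
      intro n
      obtain ⟨F, hF, hFc, hlt⟩ := hC.exists_isClosed_sdiff_lt (μ := η) (measure_ne_top _ _)
        (ε := ((n : ℝ≥0∞) + 1)⁻¹) (by simp)
      exact ⟨F, hF, hFc, hlt⟩
    choose F hFC hF hlt using hex
    refine H.glue_of_subset H' hC (fun n => (hF n).measurableSet) hFC
      (fun n => H.glue_isClosed hμ hμν H' (hF n) (hCb.subset (hFC n))) ?_
    have h1 : ∀ n, eLpNorm ((C \ F n).indicator (G + G')) 2 μ = (η (C \ F n)) ^ (1 / 2 : ℝ) := by
      intro n
      have hm := hC.diff (hF n).measurableSet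
      rw [eLpNorm_two_eq, withDensity_apply _ hm, ← lintegral_indicator hm]
      congr 2
      ext x
      by_cases hx : x ∈ C \ F n
      · rw [Set.indicator_of_mem hx, Set.indicator_of_mem hx]
      · rw [Set.indicator_of_notMem hx, Set.indicator_of_notMem hx]
        simp
    simp only [h1]
    have hlim : Tendsto (fun n : ℕ => ((n : ℝ≥0∞) + 1)⁻¹) atTop (𝓝 0) := by
      have := (tendsto_add_atTop_iff_nat 1).2 ENNReal.tendsto_inv_nat_nhds_zero
      simpa using this
    have h2 : Tendsto (fun n => η (C \ F n)) atTop (𝓝 0) :=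
      tendsto_of_tendsto_of_tendsto_of_le_of_le tendsto_const_nhds hlim (fun _ => zero_le)
        fun n => (hlt n).le
    have h5 := (ENNReal.continuous_rpow_const (y := (1 / 2 : ℝ))).tendsto 0
    rw [ENNReal.zero_rpow_of_pos (by norm_num)] at h5
    exact h5.comp h2
  rcases isEmpty_or_nonempty X with hX | ⟨⟨x₀⟩⟩
  · exact H.mono ((H'.2.1.indicator hB).add (H.2.1.indicator hB.compl))
      (ae_of_all _ fun x => hX.elim x)
  have hm : ∀ n : ℕ, MeasurableSet (B ∩ Metric.closedBall x₀ n) :=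
    fun n => hB.inter Metric.isClosed_closedBall.measurableSet
  refine H.glue_of_subset H' hB hm (fun n => Set.inter_subset_left)
    (fun n => key _ (hm n) (Metric.isBounded_closedBall.subset Set.inter_subset_right)) ?_
  refine tendsto_eLpNorm_zero_of_dominated hsum
    (fun n => (hsum.indicator (hB.diff (hm n))).1) (fun n => ?_) (ae_of_all _ fun x => ?_)
  · filter_upwards [H.nonneg, H'.nonneg] with x hx hx'
    exact (norm_indicator_le_norm_self _ x).trans (Real.norm_of_nonneg (add_nonneg hx hx')).le
  · refine tendsto_const_nhds.congr' ?_
    obtain ⟨N, hN⟩ := exists_nat_ge (dist x x₀)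
    filter_upwards [eventually_ge_atTop N] with n hn
    refine (Set.indicator_of_notMem (fun h => h.2 ⟨h.1, ?_⟩) _).symm
    exact hN.trans (by exact_mod_cast hn)

theorem ApproxSlope.min [IsFiniteMeasure ν]
    (hμ : ∀ B : Set X, Bornology.IsBounded B → μ B < ∞) (hμν : μ ≪ ν)
    (H : ApproxSlope ν μ f G) (H' : ApproxSlope ν μ f G') :
    ApproxSlope ν μ f (fun x => min (G x) (G' x)) := by
  -- Measurable representatives are needed for the comparison set `{K' < K}` to be Borel.
  have e := H.2.1.1.ae_eq_mk
  have e' := H'.2.1.1.ae_eq_mk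
  set K := H.2.1.1.mk G
  set K' := H'.2.1.1.mk G'
  have hK : ApproxSlope ν μ f K := H.mono (H.2.1.ae_eq e) e.le
  have hK' : ApproxSlope ν μ f K' := H'.mono (H'.2.1.ae_eq e') e'.le
  have hB : MeasurableSet {x | K' x < K x} := measurableSet_lt
    H'.2.1.1.stronglyMeasurable_mk.measurable H.2.1.1.stronglyMeasurable_mk.measurable
  refine (hK.glue hμ hμν hK' hB).mono (H.2.1.inf H'.2.1) ?_
  filter_upwards [e, e'] with x hx hx'
  rw [hx, hx']
  by_cases h : K' x < K x
  · have h1 : x ∈ {x | K' x < K x} := h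
    simp [h1, h.le]
  · have h1 : x ∉ {x | K' x < K x} := h
    simp [h1, not_lt.1 h]

theorem exists_isLeastAE_approxSlope [IsFiniteMeasure ν]
    (hμ : ∀ B : Set X, Bornology.IsBounded B → μ B < ∞) (hμν : μ ≪ ν)
    (H : ApproxSlope ν μ f G) : ∃ G₀, IsLeastAE μ {G | ApproxSlope ν μ f G} G₀ := by
  refine exists_isLeastAE ⟨G, H⟩ (fun G hG => hG.2.1) (fun G hG => hG.nonneg)
    (fun G hG G' hG' => hG.min hμ hμν hG') fun Gn G hGn hG hlim => ?_
  exact .of_tendsto hGn hG (r := fun n x => Gn n x - G x) (fun n => (hGn n).2.1.sub hG) hlim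
    (fun n => ae_of_all _ fun x => by simp) (ae_of_all _ fun _ => tendsto_const_nhds)

end Gluing

/-! ### Weak, strong and `L⁰` convergence -/

theorem tendsto_of_mem_convexHull {W : Type*} [AddCommGroup W] [Module ℝ W] (L : W →ₗ[ℝ] ℝ)
    {p q : ℕ → W} (hq : ∀ n, q n ∈ convexHull ℝ (p '' Set.Ici n)) {c : ℝ}
    (h : Tendsto (fun n => L (p n)) atTop (𝓝 c)) : Tendsto (fun n => L (q n)) atTop (𝓝 c) := by
  rw [Metric.tendsto_atTop'] at h ⊢
  intro ε hε
  obtain ⟨N, hN⟩ := h ε hε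
  refine ⟨N, fun n hn => ?_⟩
  have : convexHull ℝ (p '' Set.Ici n) ⊆ L ⁻¹' Metric.ball c ε := by
    refine convexHull_min ?_ ((convex_ball c ε).linear_preimage L)
    rintro _ ⟨k, hk, rfl⟩
    exact hN k (lt_of_lt_of_le hn hk)
  exact this (hq n)

theorem isLeastAE_leastAE {X : Type*} [MeasurableSpace X] {μ : Measure X} {S : Set (X → ℝ)}
    (h : ∃ G, IsLeastAE μ S G) : IsLeastAE μ S (leastAE μ S) := by
  rw [leastAE, dif_pos h]
  exact h.choose_spec

section LTwoConvergence

variable {X : Type*} [MeasurableSpace X] {ν μ : Measure X} {f G : X → ℝ}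

theorem inner_toLp {g h : X → ℝ} (hg : MemLp g 2 μ) (hh : MemLp h 2 μ) :
    inner ℝ (hh.toLp h) (hg.toLp g) = ∫ x, g x * h x ∂μ := by
  rw [L2.inner_def]
  refine integral_congr_ae ?_
  filter_upwards [hg.coeFn_toLp, hh.coeFn_toLp] with x h1 h2
  rw [h1, h2]
  simp

theorem TendstoStrongL2.tendsto_toLp {Gn : ℕ → X → ℝ} (h : TendstoStrongL2 μ Gn G) :
    Tendsto (fun n => (h.1 n).toLp (Gn n)) atTop (𝓝 (h.2.1.toLp G)) :=
  (Lp.tendsto_Lp_iff_tendsto_eLpNorm'' _ _ _ _).2 h.2.2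

theorem TendstoStrongL2.tendstoWeakL2 {Gn : ℕ → X → ℝ} (h : TendstoStrongL2 μ Gn G) :
    TendstoWeakL2 μ Gn G := by
  refine ⟨h.1, h.2.1, fun k hk => ?_⟩
  simp only [← inner_toLp (h.1 _) hk, ← inner_toLp h.2.1 hk]
  exact (tendsto_const_nhds).inner h.tendsto_toLp

theorem TendstoInMeasure.of_absolutelyContinuous [IsFiniteMeasure μ] [IsFiniteMeasure ν]
    (hνμ : ν ≪ μ) {fn : ℕ → X → ℝ} (hfn : ∀ n, AEStronglyMeasurable (fn n) μ)
    (h : TendstoInMeasure μ fn atTop f) : TendstoInMeasure ν fn atTop f := by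
  rw [exists_seq_tendstoInMeasure_atTop_iff fun n => (hfn n).mono_ac hνμ]
  intro ns hns
  obtain ⟨ns', h1, h2⟩ := (exists_seq_tendstoInMeasure_atTop_iff hfn).1 h ns hns
  exact ⟨ns', h1, hνμ.ae_le h2⟩

/-- For finite `ν` the mass outside a large spanning set of `μ` is small, and on the spanning set
`μ` is finite, so the hypothesis and `ν ≪ μ` apply. -/
theorem TendstoL0.tendstoInMeasure [SigmaFinite μ] [IsFiniteMeasure ν] (hνμ : ν ≪ μ)
    {fn : ℕ → X → ℝ} (hfn : ∀ n, AEStronglyMeasurable (fn n) μ) (h : TendstoL0 μ fn f) :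
    TendstoInMeasure ν fn atTop f := by
  intro ε hε
  rw [ENNReal.tendsto_nhds_zero]
  intro δ hδ
  set S := spanningSets μ
  have hS : ∀ k, MeasurableSet (S k) := measurableSet_spanningSets μ
  have h0 : Tendsto (fun k => ν (S k)ᶜ) atTop (𝓝 0) := by
    have h1 := tendsto_measure_iInter_atTop (μ := ν) (s := fun k => (S k)ᶜ)
      (fun k => (hS k).compl.nullMeasurableSet)
      (fun i j hij => Set.compl_subset_compl.2 (monotone_spanningSets μ hij))
      ⟨0, measure_ne_top _ _⟩
    rwa [← Set.compl_iUnion, iUnion_spanningSets, Set.compl_univ, measure_empty] at h1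
  have hδ2 : 0 < δ / 2 := ENNReal.half_pos hδ.ne'
  obtain ⟨k, hk⟩ := (h0.eventually (ge_mem_nhds hδ2)).exists
  have : Fact (μ (S k) < ∞) := ⟨measure_spanningSets_lt_top μ k⟩
  have h2 := TendstoInMeasure.of_absolutelyContinuous (hνμ.restrict (S k))
    (fun n => (hfn n).restrict) (h (S k) (hS k) (measure_spanningSets_lt_top μ k)) ε hε
  filter_upwards [h2.eventually (ge_mem_nhds hδ2)] with n hn
  set A := {x | ε ≤ edist (fn n x) (f x)}
  rw [Measure.restrict_apply' (hS k)] at hn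
  calc ν A ≤ ν (A ∩ S k ∪ (S k)ᶜ) := measure_mono fun x hx => by
        by_cases hxS : x ∈ S k
        · exact Or.inl ⟨hx, hxS⟩
        · exact Or.inr hxS
    _ ≤ ν (A ∩ S k) + ν (S k)ᶜ := measure_union_le _ _
    _ ≤ δ / 2 + δ / 2 := add_le_add hn hk
    _ = δ := ENNReal.add_halves δ

theorem tendstoL0_of_ae {fn : ℕ → X → ℝ} (hfn : ∀ n, AEStronglyMeasurable (fn n) μ)
    (h : ∀ᵐ x ∂μ, Tendsto (fun n => fn n x) atTop (𝓝 (f x))) : TendstoL0 μ fn f := by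
  intro s hs hfin
  have : Fact (μ s < ∞) := ⟨hfin⟩
  exact tendstoInMeasure_of_tendsto_ae (fun n => (hfn n).restrict) (ae_restrict_of_ae h)

end LTwoConvergence

/-- Pairs of a function and an upper bound for its slope form a convex set, so every element of the
hull of such pairs is again such a pair. -/
theorem convex_lipAReal_le {X : Type*} [MetricSpace X] [MeasurableSpace X] {μ : Measure X} :
    Convex ℝ {v : (X → ℝ) × Lp ℝ 2 μ | LipBd v.1 ∧ lipAReal v.1 ≤ᵐ[μ] v.2} := by
  rintro ⟨h, y⟩ ⟨hh, hy⟩ ⟨h', y'⟩ ⟨hh', hy'⟩ a b ha hb hab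
  refine ⟨hh.combo ha hb hh', ?_⟩
  change lipAReal (fun x => a * h x + b * h' x) ≤ᵐ[μ] (a • y + b • y' : Lp ℝ 2 μ)
  filter_upwards [hy, hy', Lp.coeFn_add (a • y) (b • y'), Lp.coeFn_smul a y,
    Lp.coeFn_smul b y'] with x h1 h2 h3 h4 h5
  rw [h3, Pi.add_apply, h4, h5]
  have h6 := mul_le_mul_of_nonneg_left h1 ha
  have h7 := mul_le_mul_of_nonneg_left h2 hb
  have h8 := lipAReal_combo_le ha hb hh hh' x
  simp only [Pi.smul_apply, smul_eq_mul]
  linarith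

/-! ### Relaxed slopes versus approximate slopes -/

section MinimalSlopes

variable {X : Type*} [MetricSpace X] [MeasurableSpace X] [BorelSpace X] {ν μ : Measure X}
  {f G : X → ℝ}

/-- Limits of forward convex combinations of asymptotic Lipschitz constants are slopes. -/
theorem approxSlope_of_convexHull [IsFiniteMeasure ν] {p q : ℕ → (X → ℝ) × Lp ℝ 2 μ} {l : Lp ℝ 2 μ}
    (hp : ∀ n, LipBd (p n).1 ∧ lipAReal (p n).1 ≤ᵐ[μ] (p n).2)
    (hq : ∀ n, q n ∈ convexHull ℝ (p '' Set.Ici n))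
    (hl : Tendsto (fun n => (q n).2) atTop (𝓝 l))
    (hf : ∀ᵐ x ∂ν, Tendsto (fun n => (p n).1 x) atTop (𝓝 (f x))) : ApproxSlope ν μ f l := by
  have hqR : ∀ n, LipBd (q n).1 ∧ lipAReal (q n).1 ≤ᵐ[μ] (q n).2 := fun n =>
    (convexHull_min (by rintro _ ⟨k, -, rfl⟩; exact hp k) convex_lipAReal_le) (hq n)
  refine SlopeSeq.approxSlope (h := fun n => (q n).1) (r := fun n => ((q n).2 - l : Lp ℝ 2 μ))
    ⟨fun n => (hqR n).1, fun n => Lp.memLp _, ?_, fun n => ?_⟩ (Lp.memLp l) ?_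
  · have h1 := (tendsto_iff_edist_tendsto_0.1 hl)
    refine h1.congr fun n => ?_
    rw [edist_eq_enorm_sub, Lp.enorm_def]
  · filter_upwards [(hqR n).2, Lp.coeFn_sub (q n).2 l] with x h1 h2
    rw [h2, Pi.sub_apply]
    linarith
  · filter_upwards [hf] with x hx
    exact tendsto_of_mem_convexHull ((LinearMap.proj x).comp (LinearMap.fst ℝ (X → ℝ) (Lp ℝ 2 μ)))
      hq hx

/-- Mazur's lemma replaces the weakly convergent slopes by strongly convergent convex combinations,
and the functions are averaged along with them. A subsequence is taken first, to have convergence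
almost everywhere, which averaging of tails preserves. -/
theorem approxSlope_of_mem_relaxedSlopes [SigmaFinite μ] [IsFiniteMeasure ν] (hνμ : ν ≪ μ)
    (hG : G ∈ relaxedSlopes μ f) : ApproxSlope ν μ f G := by
  obtain ⟨fn, hfn, hL0, hmem, hGm, hweak⟩ := hG
  obtain ⟨φ, hφ, hae⟩ := (hL0.tendstoInMeasure hνμ
    fun n => (hfn n).aestronglyMeasurable).exists_seq_tendsto_ae
  set p : ℕ → (X → ℝ) × Lp ℝ 2 μ := fun n => (fn (φ n), (hmem (φ n)).toLp _)
  obtain ⟨q, hq, hl⟩ := exists_convexHull_tendsto_of_weak p (hGm.toLp G) fun h => by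
    have e : h = (Lp.memLp h).toLp h := (Lp.toLp_coeFn h (Lp.memLp h)).symm
    rw [e]
    simp only [p, inner_toLp]
    exact (hweak _ (Lp.memLp h)).comp hφ.tendsto_atTop
  have := approxSlope_of_convexHull (ν := ν) (f := f) (p := p)
    (fun n => ⟨hfn _, (hmem (φ n)).coeFn_toLp.symm.le⟩) hq hl hae
  exact this.mono hGm hGm.coeFn_toLp.le

/-- Sequences in `LIP_bd` that approximate the least slope have a subsequence whose asymptotic
Lipschitz constants converge strongly. -/
theorem SlopeSeq.exists_tendstoStrongL2 [IsFiniteMeasure ν]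
    (hG : IsLeastAE μ {G | ApproxSlope ν μ f G} G) {h r : ℕ → X → ℝ} (H : SlopeSeq μ G h r)
    (hf : ∀ᵐ x ∂ν, Tendsto (fun n => h n x) atTop (𝓝 (f x))) :
    ∃ φ : ℕ → ℕ, Tendsto φ atTop atTop ∧ TendstoStrongL2 μ (fun n => lipAReal (h (φ n))) G := by
  have hGm : MemLp G 2 μ := hG.1.2.1
  have hmem : ∀ n, MemLp (lipAReal (h n)) 2 μ := fun n =>
    (H.lipBd n).memLp_lipAReal (hGm.add (H.memLp n)) (H.le n)
  set p : ℕ → (X → ℝ) × Lp ℝ 2 μ := fun n => (h n, (hmem n).toLp _)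
  have hnorm : ∀ n, ‖(p n).2‖ ≤ ‖hGm.toLp G‖ + (eLpNorm (r n) 2 μ).toReal := by
    intro n
    rw [← Lp.norm_toLp _ (H.memLp n)]
    refine le_trans ?_ (norm_add_le _ _)
    rw [← MemLp.toLp_add]
    refine Lp.norm_le_norm_of_ae_le ?_
    filter_upwards [(hmem n).coeFn_toLp, (hGm.add (H.memLp n)).coeFn_toLp, H.le n] with x h1 h2 h3
    rw [h1, h2, Real.norm_of_nonneg (lipAReal_nonneg _ _)]
    exact h3.trans (le_abs_self _)
  -- Any limit `l` of averaged slopes is itself an approximate slope, so `G ≤ l` by minimality, and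
  -- `∫ G² ≤ ∫ G l` because `G ≥ 0`.
  have hinner : ∀ (q : ℕ → (X → ℝ) × Lp ℝ 2 μ) (l : Lp ℝ 2 μ),
      (∀ n, q n ∈ convexHull ℝ (p '' Set.Ici n)) → Tendsto (fun n => (q n).2) atTop (𝓝 l) →
      ‖hGm.toLp G‖ ^ 2 ≤ inner ℝ (hGm.toLp G) l := by
    intro q l hq hl
    have hlS := approxSlope_of_convexHull (ν := ν) (f := f) (p := p)
      (fun n => ⟨H.lipBd n, (hmem n).coeFn_toLp.symm.le⟩) hq hl hf
    have hle := hG.2 _ hlS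
    have e : l = (Lp.memLp l).toLp l := (Lp.toLp_coeFn l (Lp.memLp l)).symm
    rw [← real_inner_self_eq_norm_sq, e, inner_toLp, inner_toLp]
    refine integral_mono_ae (hGm.integrable_mul hGm) ((Lp.memLp l).integrable_mul hGm) ?_
    filter_upwards [hle, hG.1.nonneg] with x h1 h2
    exact mul_le_mul_of_nonneg_right h1 h2
  obtain ⟨φ, hφ, hlim⟩ := exists_tendsto_of_inner_convexHull p (hGm.toLp G)
    (fun n => (eLpNorm (r n) 2 μ).toReal)
    (by simpa [Function.comp_def] using
      (ENNReal.tendsto_toReal ENNReal.zero_ne_top).comp H.tendsto) hnorm hinner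
  exact ⟨φ, tendsto_atTop_mono hφ tendsto_id, fun n => hmem _, hGm,
    (Lp.tendsto_Lp_iff_tendsto_eLpNorm'' _ (fun n => hmem (φ n)) _ _).1 hlim⟩

/-- An approximate slope is only an upper bound; it is the least one that is attained as a strong,
hence weak, limit of asymptotic Lipschitz constants. -/
theorem mem_relaxedSlopes_of_isLeastAE [IsFiniteMeasure ν] (hμν : μ ≪ ν)
    (hG : IsLeastAE μ {G | ApproxSlope ν μ f G} G) : G ∈ relaxedSlopes μ f := by
  obtain ⟨h, r, hS, hf, -⟩ := ApproxSlope.exists_seq hG.1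
  obtain ⟨φ, hφ, hlim⟩ := hS.exists_tendstoStrongL2 hG hf
  refine ⟨fun n => h (φ n), fun n => hS.lipBd _, tendstoL0_of_ae
    (fun n => (hS.lipBd _).aestronglyMeasurable) ?_, hlim.tendstoWeakL2⟩
  filter_upwards [hμν.ae_le hf] with x hx
  exact hx.comp hφ

/-- The minimal weak upper gradient exists as soon as there is an approximate slope, and is also the
least approximate slope. -/
theorem ApproxSlope.minimalWUG_spec [SigmaFinite μ] [IsFiniteMeasure ν]
    (hμ : ∀ B : Set X, Bornology.IsBounded B → μ B < ∞) (hμν : μ ≪ ν) (hνμ : ν ≪ μ)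
    (H : ApproxSlope ν μ f G) :
    MemS2 μ f ∧ IsLeastAE μ (relaxedSlopes μ f) (minimalWUG μ f) ∧
      IsLeastAE μ {G | ApproxSlope ν μ f G} (minimalWUG μ f) := by
  obtain ⟨G₀, hG₀⟩ := exists_isLeastAE_approxSlope hμ hμν H
  have hrel := mem_relaxedSlopes_of_isLeastAE hμν hG₀
  have hleast : IsLeastAE μ (relaxedSlopes μ f) (minimalWUG μ f) := isLeastAE_leastAE
    ⟨G₀, hrel, fun G' hG' => hG₀.2 _ (approxSlope_of_mem_relaxedSlopes hνμ hG')⟩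
  refine ⟨⟨H.1.mono_ac hμν, _, hrel⟩, hleast,
    approxSlope_of_mem_relaxedSlopes hνμ hleast.1, fun G' hG' => ?_⟩
  exact (hleast.2 _ hrel).trans (hG₀.2 _ hG')

theorem MemS2.minimalWUG_spec [SigmaFinite μ] [IsFiniteMeasure ν]
    (hμ : ∀ B : Set X, Bornology.IsBounded B → μ B < ∞) (hμν : μ ≪ ν) (hνμ : ν ≪ μ)
    (H : MemS2 μ f) :
    IsLeastAE μ (relaxedSlopes μ f) (minimalWUG μ f) ∧
      IsLeastAE μ {G | ApproxSlope ν μ f G} (minimalWUG μ f) :=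
  have ⟨_, hG⟩ := H.2
  ((approxSlope_of_mem_relaxedSlopes hνμ hG).minimalWUG_spec hμ hμν hνμ).2

end MinimalSlopes

/-! ### Truncations and their common convex combinations -/

/-- A `1`-Lipschitz function that is the identity on `[-K, K]` and vanishes outside
`[-2K, 2K]`. -/
def fold (K t : ℝ) : ℝ := max (min t (max (2 * K - t) 0)) (min 0 (-(2 * K) - t))

theorem fold_lipschitz (K s t : ℝ) : |fold K s - fold K t| ≤ |s - t| := by
  have h : ∀ c : ℝ, |c - s - (c - t)| ≤ |s - t| := fun c => by
    rw [← abs_neg]; apply le_of_eq; congr 1; ring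
  refine (abs_max_sub_max_le_max _ _ _ _).trans (max_le ?_ ?_)
  · refine (abs_min_sub_min_le_max _ _ _ _).trans (max_le le_rfl ?_)
    exact (abs_max_sub_max_le_max _ _ _ _).trans (max_le (h _) (by simp))
  · exact (abs_min_sub_min_le_max _ _ _ _).trans (max_le (by simp) (h _))

theorem fold_eq_self {K t : ℝ} (h : |t| ≤ K) : fold K t = t := by
  obtain ⟨h1, h2⟩ := abs_le.1 h
  rw [fold, max_eq_left (by linarith : (0 : ℝ) ≤ 2 * K - t), min_eq_left (by linarith),
    min_eq_right (by linarith), max_eq_left (by linarith)]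

theorem fold_eq_zero {K t : ℝ} (hK : 0 ≤ K) (h : 2 * K ≤ |t|) : fold K t = 0 := by
  rcases le_abs.1 h with h | h
  · rw [fold, max_eq_right (by linarith : 2 * K - t ≤ 0), min_eq_right (by linarith),
      min_eq_right (by linarith), max_eq_left (by linarith)]
  · rw [fold, max_eq_left (by linarith : (0 : ℝ) ≤ 2 * K - t), min_eq_left (by linarith),
      min_eq_left (by linarith), max_eq_right (by linarith)]

theorem continuous_fold (K : ℝ) : Continuous (fold K) := by
  unfold fold
  fun_prop

/-- Since `fold K` vanishes for large arguments, the jump of `EReal.toReal` to `0` at `±∞` does no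
harm. This lets limits with infinite values be handled by real functions. -/
theorem continuous_fold_toReal {K : ℝ} (hK : 0 ≤ K) :
    Continuous fun x : EReal => fold K x.toReal := by
  have h0 : fold K 0 = 0 := fold_eq_self (by simpa using hK)
  rw [continuous_iff_continuousAt]
  intro x
  induction x with
  | bot =>
    rw [ContinuousAt, EReal.toReal_bot, h0]
    refine tendsto_const_nhds.congr' ?_
    filter_upwards [gt_mem_nhds (EReal.bot_lt_coe (-(2 * K)))] with y hy
    induction y with
    | bot => simp [h0]
    | top => simp [h0]
    | coe y =>
      rw [EReal.toReal_coe, fold_eq_zero hK]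
      have := EReal.coe_lt_coe_iff.1 hy
      rw [le_abs]
      right
      linarith
  | top =>
    rw [ContinuousAt, EReal.toReal_top, h0]
    refine tendsto_const_nhds.congr' ?_
    filter_upwards [lt_mem_nhds (EReal.coe_lt_top (2 * K))] with y hy
    induction y with
    | bot => simp [h0]
    | top => simp [h0]
    | coe y =>
      rw [EReal.toReal_coe, fold_eq_zero hK]
      have := EReal.coe_lt_coe_iff.1 hy
      rw [le_abs]
      left
      linarith
  | coe x =>
    exact ((continuous_fold K).tendsto _).comp
      (EReal.tendsto_toReal (EReal.coe_ne_top x) (EReal.coe_ne_bot x))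

/-- Truncation to the interval `[-L, M]`. -/
def trunc (M L : ℕ) (t : ℝ) : ℝ := max (min t M) (-(L : ℝ))

theorem trunc_lipschitz (M L : ℕ) (s t : ℝ) : |trunc M L s - trunc M L t| ≤ |s - t| := by
  refine (abs_max_sub_max_le_max _ _ _ _).trans (max_le ?_ (by simp))
  exact (abs_min_sub_min_le_max _ _ _ _).trans (max_le le_rfl (by simp))

theorem abs_trunc_le (M L : ℕ) (t : ℝ) : |trunc M L t| ≤ M + L + 1 := by
  have hM : (0 : ℝ) ≤ M := M.cast_nonneg
  have hL : (0 : ℝ) ≤ L := L.cast_nonneg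
  rw [trunc, abs_le]
  constructor
  · linarith [le_max_right (min t M) (-(L : ℝ))]
  · exact max_le (by linarith [min_le_right t (M : ℝ)]) (by linarith)

theorem continuous_trunc (M L : ℕ) : Continuous (trunc M L) := by
  unfold trunc
  fun_prop

theorem trunc_mono {M M' : ℕ} (h : M ≤ M') (L : ℕ) (t : ℝ) : trunc M L t ≤ trunc M' L t := by
  unfold trunc
  gcongr

theorem trunc_anti (M : ℕ) {L L' : ℕ} (h : L ≤ L') (t : ℝ) : trunc M L' t ≤ trunc M L t := by
  unfold trunc
  gcongr

theorem iInf_iSup_trunc (t : ℝ) : ⨅ L : ℕ, ⨆ M : ℕ, ((trunc M L t : ℝ) : EReal) = t := by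
  have h1 : ∀ L : ℕ, ⨆ M : ℕ, ((trunc M L t : ℝ) : EReal) = (max t (-(L : ℝ)) : ℝ) := by
    intro L
    refine le_antisymm (iSup_le fun M => EReal.coe_le_coe ?_) ?_
    · exact max_le_max (min_le_left _ _) le_rfl
    · obtain ⟨M, hM⟩ := exists_nat_ge t
      refine le_trans (EReal.coe_le_coe ?_) (le_iSup (fun M : ℕ => ((trunc M L t : ℝ) : EReal)) M)
      rw [trunc, min_eq_left hM]
  simp only [h1]
  refine le_antisymm ?_ (le_iInf fun L => EReal.coe_le_coe (le_max_left _ _))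
  obtain ⟨L, hL⟩ := exists_nat_ge (-t)
  refine (iInf_le _ L).trans (EReal.coe_le_coe ?_)
  rw [max_eq_left (by linarith)]

/-- The functions `F i`, `i : ℕ × ℕ`, seen as one function on a product space, with weights that
make the truncations at the levels `i` bounded. -/
noncomputable def weighted {Y : Type*} (F : ℕ × ℕ → Y → ℝ) (z : Y × (ℕ × ℕ)) : ℝ :=
  F z.2 z.1 / (z.2.1 + z.2.2 + 1)

/-- Convex combinations of all truncations of a sequence can be chosen to converge almost
everywhere, simultaneously at all levels of truncation. -/
theorem exists_convexHull_trunc_tendsto {Y : Type*} [MeasurableSpace Y] {ν : Measure Y}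
    [IsFiniteMeasure ν] {h : ℕ → Y → ℝ}
    (hh : ∀ n, Measurable (h n)) :
    ∃ H : ℕ → ℕ × ℕ → Y → ℝ,
      (∀ n, H n ∈ convexHull ℝ ((fun k (i : ℕ × ℕ) y => trunc i.1 i.2 (h k y)) '' Set.Ici n)) ∧
      ∃ φ : ℕ → ℕ, StrictMono φ ∧
        ∀ᵐ y ∂ν, ∀ i, ∃ c, Tendsto (fun n => H (φ n) i y) atTop (𝓝 c) := by
  set F : ℕ → ℕ × ℕ → Y → ℝ := fun k i y => trunc i.1 i.2 (h k y) with hF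
  -- A finite measure charging every index. Convergence in `L²(ν × κ)` treats all truncation levels
  -- with the same coefficients, and almost everywhere for `κ` means at every level.
  set κ : Measure (ℕ × ℕ) := (Measure.count : Measure (ℕ × ℕ)).toFinite
  set π : Measure (Y × (ℕ × ℕ)) := ν.prod κ
  have hmeas : ∀ k, Measurable (weighted (F k)) := fun k =>
    measurable_from_prod_countable_left fun i =>
      ((continuous_trunc i.1 i.2).measurable.comp (hh k)).div_const ((i.1 : ℝ) + i.2 + 1)
  have hbound : ∀ k z, ‖weighted (F k) z‖ ≤ 1 := by
    intro k z
    have : (0 : ℝ) < z.2.1 + z.2.2 + 1 := by positivity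
    rw [weighted, norm_div, Real.norm_eq_abs, Real.norm_of_nonneg this.le, div_le_one this]
    exact abs_trunc_le _ _ _
  have hmem : ∀ k, MemLp (weighted (F k)) 2 π := fun k =>
    MemLp.of_bound (hmeas k).aestronglyMeasurable 1 (ae_of_all _ (hbound k))
  set p : ℕ → (ℕ × ℕ → Y → ℝ) × Lp ℝ 2 π := fun k => (F k, (hmem k).toLp _) with hp
  obtain ⟨q, hq, l, hl⟩ := exists_convexHull_tendsto p
    (C := (π.real Set.univ) ^ (2 : ℝ≥0∞).toReal⁻¹ * 1) fun k => by
      refine Lp.norm_le_of_ae_bound zero_le_one ?_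
      filter_upwards [(hmem k).coeFn_toLp] with z hz
      rw [hz]
      exact hbound k z
  have hq1 : ∀ n, (q n).1 ∈ convexHull ℝ (F '' Set.Ici n) := by
    intro n
    have h1 : (q n).1 ∈ (LinearMap.fst ℝ (ℕ × ℕ → Y → ℝ) (Lp ℝ 2 π)) ''
      convexHull ℝ (p '' Set.Ici n) := ⟨_, hq n, rfl⟩
    rwa [LinearMap.image_convexHull, Set.image_image] at h1
  have hq2 : ∀ n, (q n).2 =ᵐ[π] weighted (q n).1 := by
    intro n
    have hconv : Convex ℝ {v : (ℕ × ℕ → Y → ℝ) × Lp ℝ 2 π | v.2 =ᵐ[π] weighted v.1} := by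
      rintro ⟨u, x⟩ hx ⟨u', x'⟩ hx' a b - - -
      change (a • x + b • x' : Lp ℝ 2 π) =ᵐ[π] weighted (a • u + b • u')
      filter_upwards [hx, hx', Lp.coeFn_add (a • x) (b • x'), Lp.coeFn_smul a x,
        Lp.coeFn_smul b x'] with z h1 h2 h3 h4 h5
      rw [h3, Pi.add_apply, h4, h5, Pi.smul_apply, Pi.smul_apply, h1, h2]
      simp only [weighted, Pi.add_apply, Pi.smul_apply, smul_eq_mul]
      ring
    refine (convexHull_min ?_ hconv) (hq n)
    rintro _ ⟨k, -, rfl⟩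
    exact (hmem k).coeFn_toLp
  obtain ⟨φ, hφ, hae⟩ := (tendstoInMeasure_of_tendsto_Lp hl).exists_seq_tendsto_ae
  refine ⟨fun n => (q n).1, hq1, φ, hφ, ?_⟩
  have h1 : ∀ᵐ z ∂π, ∃ c, Tendsto (fun n => weighted (q (φ n)).1 z) atTop (𝓝 c) := by
    filter_upwards [hae, ae_all_iff.2 hq2] with z hz hz2
    exact ⟨_, hz.congr fun n => hz2 _⟩
  filter_upwards [Measure.ae_ae_of_ae_prod h1] with y hy i
  rw [ae_toFinite] at hy
  have hi : ∀ i, ∃ c, Tendsto (fun n => weighted (q (φ n)).1 (y, i)) atTop (𝓝 c) := by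
    simpa [Measure.ae_count_iff] using hy
  obtain ⟨c, hc⟩ := hi i
  refine ⟨_, (hc.mul_const ((i.1 : ℝ) + i.2 + 1)).congr fun n => ?_⟩
  have : ((i.1 : ℝ) + i.2 + 1) ≠ 0 := by positivity
  rw [weighted, div_mul_cancel₀ _ this]

/-! ### Extension to a larger measure -/

section Extension

variable {Y : Type*} [MetricSpace Y] [MeasurableSpace Y] [BorelSpace Y] {ν μ : Measure Y}
  {f G : Y → ℝ}

theorem approxSlope_of_eventually_mem_slopeBall [IsFiniteMeasure ν] {h : ℕ → Y → ℝ}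
    (hG : MemLp G 2 μ) (hh : ∀ n, LipBd (h n))
    (hmem : ∀ ε : ℝ≥0∞, ε ≠ 0 → ∀ᶠ n in atTop, h n ∈ slopeBall μ G ε)
    (hf : ∀ᵐ x ∂ν, Tendsto (fun n => h n x) atTop (𝓝 (f x))) : ApproxSlope ν μ f G := by
  have hfm : AEStronglyMeasurable f ν :=
    aestronglyMeasurable_of_tendsto_ae atTop (fun n => (hh n).aestronglyMeasurable) hf
  refine ⟨hfm, hG, fun ε hε => ?_⟩
  obtain ⟨n, h1, h2⟩ := ((hmem ε hε).and ((tendsto_l0dist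
    (fun n => (hh n).aestronglyMeasurable) hfm hf).eventually
      (ge_mem_nhds (pos_iff_ne_zero.2 hε)))).exists
  exact ⟨_, h1, h2⟩

/-- A function with an approximate slope with respect to `μ` can be redefined on a `μ`-null set so
that it is approximated also almost everywhere for a larger finite measure `ν`. -/
theorem ApproxSlope.exists_extension [IsFiniteMeasure ν] (H : ApproxSlope μ μ f G) :
    ∃ g, g =ᵐ[μ] f ∧ ApproxSlope ν μ g G := by
  obtain ⟨h, r, hS, hlim, -⟩ := H.exists_seq
  obtain ⟨Q, hQ, φ, hφ, hae⟩ := exists_convexHull_trunc_tendsto (ν := ν)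
    fun n => (hS.lipBd n).continuous.measurable
  set F : ℕ → ℕ × ℕ → Y → ℝ := fun k i y => trunc i.1 i.2 (h k y) with hF
  let ev : ℕ × ℕ → (ℕ × ℕ → Y → ℝ) →ₗ[ℝ] (Y → ℝ) := fun i => LinearMap.proj i
  have hball : ∀ ε : ℝ≥0∞, ε ≠ 0 → ∀ᶠ n in atTop, ∀ i, Q n i ∈ slopeBall μ G ε := by
    intro ε hε
    have h1 := hS.tendsto.eventually (ge_mem_nhds (pos_iff_ne_zero.2 hε))
    obtain ⟨N, hN⟩ := eventually_atTop.1 h1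
    filter_upwards [eventually_ge_atTop N] with n hn i
    have h2 : convexHull ℝ (F '' Set.Ici n) ⊆ ev i ⁻¹' slopeBall μ G ε := by
      refine convexHull_min ?_ ((convex_slopeBall ε).linear_preimage (ev i))
      rintro _ ⟨k, hk, rfl⟩
      exact slopeBall_comp (trunc_lipschitz i.1 i.2)
        ⟨hS.lipBd k, r k, hS.memLp k, hN k (hn.trans hk), hS.le k⟩
    exact h2 (hQ n)
  have hlip : ∀ n i, LipBd (Q n i) := by
    intro n i
    have hc : Convex ℝ {u : Y → ℝ | LipBd u} := fun u hu u' hu' a b ha hb _ => hu.combo ha hb hu'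
    have h2 : convexHull ℝ (F '' Set.Ici n) ⊆ ev i ⁻¹' {u | LipBd u} := by
      refine convexHull_min ?_ (hc.linear_preimage (ev i))
      rintro _ ⟨k, hk, rfl⟩
      exact (hS.lipBd k).comp (trunc_lipschitz i.1 i.2)
    exact h2 (hQ n)
  -- All levels are averaged with the same coefficients, so the pointwise order between truncations
  -- survives.
  have horder : ∀ i j : ℕ × ℕ, (∀ t, trunc i.1 i.2 t ≤ trunc j.1 j.2 t) →
      ∀ n y, Q n i y ≤ Q n j y := by
    intro i j hij n y
    have hc : Convex ℝ {u : ℕ × ℕ → Y → ℝ | u i y ≤ u j y} := by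
      intro u hu u' hu' a b ha hb _
      have h3 := mul_le_mul_of_nonneg_left (show u i y ≤ u j y from hu) ha
      have h4 := mul_le_mul_of_nonneg_left (show u' i y ≤ u' j y from hu') hb
      change a * u i y + b * u' i y ≤ a * u j y + b * u' j y
      linarith
    have h2 : convexHull ℝ (F '' Set.Ici n) ⊆ {u | u i y ≤ u j y} := by
      refine convexHull_min ?_ hc
      rintro _ ⟨k, hk, rfl⟩
      exact hij _
    exact h2 (hQ n)
  -- The limsup is defined at every point, so order in the levels holds everywhere and not only
  -- almost everywhere. It is the genuine limit `ν`-a.e.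
  set a : ℕ × ℕ → Y → EReal := fun i y => limsup (fun n => (Q (φ n) i y : EReal)) atTop with ha
  have ha_eq : ∀ {i y c}, Tendsto (fun n => Q (φ n) i y) atTop (𝓝 c) → a i y = c :=
    fun hc => ((continuous_coe_real_ereal.tendsto _).comp hc).limsup_eq
  have ha_order : ∀ i j : ℕ × ℕ, (∀ t, trunc i.1 i.2 t ≤ trunc j.1 j.2 t) → ∀ y, a i y ≤ a j y :=
    fun i j hij y => limsup_le_limsup
      (Eventually.of_forall fun n => EReal.coe_le_coe (horder i j hij _ y))
  have ha_mono : ∀ L y, Monotone fun M => a (M, L) y := fun L y M M' hM =>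
    ha_order (M, L) (M', L) (trunc_mono hM L) y
  have ha_anti : ∀ y, Antitone fun L => ⨆ M, a (M, L) y := fun y L L' hL =>
    iSup_mono fun M => ha_order (M, L') (M, L) (trunc_anti M hL) y
  have hG := H.2.1
  have step : ∀ {u : ℕ → Y → ℝ} {v : Y → ℝ}, (∀ n, ApproxSlope ν μ (u n) G) →
      (∀ y, Tendsto (fun n => u n y) atTop (𝓝 (v y))) → ApproxSlope ν μ v G := fun hu huv =>
    .of_tendsto (r := fun _ => 0) hu hG (fun _ => MemLp.zero) (by simp) (fun _ => by simp)
      (ae_of_all _ huv)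
  -- Folding comes before the removal of the truncations: the limits over the levels may be
  -- infinite, and only their folded versions are limits of real functions.
  have h1 : ∀ (K : ℕ) (i : ℕ × ℕ), ApproxSlope ν μ (fun y => fold K (a i y).toReal) G := by
    intro K i
    refine approxSlope_of_eventually_mem_slopeBall (h := fun n y => fold K (Q (φ n) i y)) hG
      (fun n => (hlip _ i).comp (fold_lipschitz K)) (fun ε hε => ?_) ?_
    · filter_upwards [hφ.tendsto_atTop.eventually (hball ε hε)] with n hn
      exact slopeBall_comp (fold_lipschitz K) (hn i)
    · filter_upwards [hae] with y hy
      obtain ⟨c, hc⟩ := hy i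
      rw [ha_eq hc, EReal.toReal_coe]
      exact ((continuous_fold K).tendsto c).comp hc
  have h2 : ∀ K L : ℕ, ApproxSlope ν μ (fun y => fold K (⨆ M, a (M, L) y).toReal) G := fun K L =>
    step (fun M => h1 K (M, L)) fun y =>
      ((continuous_fold_toReal K.cast_nonneg).tendsto _).comp (tendsto_atTop_iSup (ha_mono L y))
  have h3 : ∀ K : ℕ, ApproxSlope ν μ (fun y => fold K (⨅ L, ⨆ M, a (M, L) y).toReal) G := fun K =>
    step (fun L => h2 K L) fun y =>
      ((continuous_fold_toReal K.cast_nonneg).tendsto _).comp (tendsto_atTop_iInf (ha_anti y))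
  -- At `μ`-almost every point the original sequence converges to `f`, so each level gives the
  -- truncation of `f`, and the iterated limit gives `f`. Folding at level `K` fixes the value at a
  -- given point once `K` is large, which removes `fold`.
  refine ⟨fun y => (⨅ L, ⨆ M, a (M, L) y).toReal, ?_, step h3 fun y => ?_⟩
  · filter_upwards [hlim] with y hy
    have h4 : ∀ i, a i y = (trunc i.1 i.2 (f y) : ℝ) := by
      intro i
      refine ha_eq ((tendsto_of_mem_convexHull (L := (LinearMap.proj y).comp (ev i)) hQ ?_).comp
        hφ.tendsto_atTop)
      exact ((continuous_trunc i.1 i.2).tendsto _).comp hy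
    simp only [h4]
    rw [iInf_iSup_trunc, EReal.toReal_coe]
  · obtain ⟨N, hN⟩ := exists_nat_ge |(⨅ L, ⨆ M, a (M, L) y).toReal|
    refine tendsto_const_nhds.congr' ?_
    filter_upwards [eventually_ge_atTop N] with K hK
    exact (fold_eq_self (hN.trans (by exact_mod_cast hK))).symm

end Extension

/-! ### Locality of the minimal slope -/

theorem sigmaFinite_of_isBounded {X : Type*} [MetricSpace X] [MeasurableSpace X] {m : Measure X}
    (hm : ∀ B : Set X, Bornology.IsBounded B → m B < ∞) : SigmaFinite m := by
  rcases isEmpty_or_nonempty X with hX | ⟨⟨x₀⟩⟩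
  · rw [m.eq_zero_of_isEmpty]
    infer_instance
  · exact ⟨⟨⟨fun n : ℕ => Metric.closedBall x₀ n, fun _ => trivial,
      fun n => hm _ Metric.isBounded_closedBall, Metric.iUnion_closedBall_nat x₀⟩⟩⟩

section Locality

variable {X : Type*} [MetricSpace X] [MeasurableSpace X] [BorelSpace X] {m : Measure X}
  {g₁ g₂ : X → ℝ}

/-- Write `g₁ = g₂ + (g₁ - g₂)`. The slope of the difference may be taken to be `0` where the
difference vanishes, so there `g₁` has a slope equal to that of `g₂`. -/
theorem minimalWUG_le_of_eq [SigmaFinite m] (hm : ∀ B : Set X, Bornology.IsBounded B → m B < ∞)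
    (h₁ : MemS2 m g₁) (h₂ : MemS2 m g₂) :
    ∀ᵐ x ∂m, g₁ x = g₂ x → minimalWUG m g₁ x ≤ minimalWUG m g₂ x := by
  have hac := absolutelyContinuous_toFinite m
  have s₁ := (h₁.minimalWUG_spec hm hac (toFinite_absolutelyContinuous m)).2
  have s₂ := (h₂.minimalWUG_spec hm hac (toFinite_absolutelyContinuous m)).2
  have a₁ : ApproxSlope m.toFinite m g₁ _ := s₁.1
  have a₂ : ApproxSlope m.toFinite m g₂ _ := s₂.1
  have adiff := a₁.add (a₂.comp (φ := fun t => -t)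
    fun s t => by rw [← abs_neg]; apply le_of_eq; congr 1; ring)
  set E : Set X := {x | h₁.1.mk g₁ x = h₂.1.mk g₂ x}ᶜ
  have hE : MeasurableSet E := (measurableSet_eq_fun h₁.1.stronglyMeasurable_mk.measurable
    h₂.1.stronglyMeasurable_mk.measurable).compl
  have aind := adiff.indicator hac hE (by
    filter_upwards [h₁.1.ae_eq_mk, h₂.1.ae_eq_mk] with x e₁ e₂ hx
    have : h₁.1.mk g₁ x = h₂.1.mk g₂ x := not_not.1 hx
    rw [e₁, e₂, this, add_neg_cancel])
  have asum := (a₂.add aind).congr (g := g₁) (ae_of_all _ fun x => by ring)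
  filter_upwards [s₁.2 _ asum, h₁.1.ae_eq_mk, h₂.1.ae_eq_mk] with x hx e₁ e₂ he
  have hxE : x ∉ E := not_not.2 (show h₁.1.mk g₁ x = h₂.1.mk g₂ x by rw [← e₁, ← e₂, he])
  simpa [hxE] using hx

end Locality

/-- A function in `LIP_bd` is the pointwise limit of Lipschitz functions with asymptotically the
same asymptotic Lipschitz constants. -/
theorem exists_lipschitz_approx_of_lipBd {Y : Type*} [MetricSpace Y] {f : Y → ℝ} (hf : LipBd f) :
    ∃ h : ℕ → Y → ℝ, (∀ n, ∃ K, LipschitzWith K (h n)) ∧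
      (∀ n y, lipAReal (h n) y ≤ lipAReal f y + 1 / ((n : ℝ) + 1)) ∧
      ∀ y, Tendsto (fun n => h n y) atTop (𝓝 (f y)) := by
  rcases isEmpty_or_nonempty Y with hY | ⟨⟨y₀⟩⟩
  · exact ⟨fun _ => f, fun n => ⟨0, fun y => hY.elim y⟩, fun n y => hY.elim y, fun y => hY.elim y⟩
  -- A cone of height `n + 1` and Lipschitz constant `1/(n+1)`, vanishing outside the ball of radius
  -- `(n+1)²`. Clamping `f` to `[-w n, w n]` gives bounded support, costs at most `1/(n+1)` in
  -- slope, and leaves `f` unchanged at each point for large `n`.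
  set w : ℕ → Y → ℝ := fun n y => max ((n : ℝ) + 1 - 1 / ((n : ℝ) + 1) * dist y y₀) 0
  have hw0 : ∀ n y, 0 ≤ w n y := fun n y => le_max_right _ _
  have hwd : ∀ n y z, |w n y - w n z| ≤ 1 / ((n : ℝ) + 1) * dist y z := by
    intro n y z
    have hpos : (0 : ℝ) ≤ 1 / ((n : ℝ) + 1) := by positivity
    refine (abs_max_sub_max_le_abs _ _ _).trans ?_
    have e : (n : ℝ) + 1 - 1 / ((n : ℝ) + 1) * dist y y₀ -
        ((n : ℝ) + 1 - 1 / ((n : ℝ) + 1) * dist z y₀) =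
        1 / ((n : ℝ) + 1) * (dist z y₀ - dist y y₀) := by ring
    rw [e, abs_mul, abs_of_nonneg hpos]
    refine mul_le_mul_of_nonneg_left ?_ hpos
    rw [dist_comm y z]
    exact abs_dist_sub_le _ _ _
  have hwL : ∀ n : ℕ, LipschitzWith (1 / ((n : ℝ≥0) + 1)) (w n) := fun n =>
    LipschitzWith.of_dist_le_mul fun y z => by
      rw [Real.dist_eq]
      simpa using hwd n y z
  have hwzero : ∀ (n : ℕ) y, y ∉ Metric.closedBall y₀ (((n : ℝ) + 1) ^ 2) → w n y = 0 := by
    intro n y hy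
    rw [Metric.mem_closedBall, not_le] at hy
    refine max_eq_right ?_
    rw [sub_nonpos, one_div, inv_mul_eq_div, le_div_iff₀ (by positivity), ← sq]
    exact hy.le
  refine ⟨fun n y => max (min (f y) (w n y)) (-w n y), fun n => ?_, fun n y => ?_, fun y => ?_⟩
  · obtain ⟨K, hK⟩ := lipBd_iff.1 hf _ (Metric.isBounded_closedBall (x := y₀)
      (r := ((n : ℝ) + 1) ^ 2))
    have habs : ∀ y, |max (min (f y) (w n y)) (-w n y)| ≤ w n y := fun y =>
      abs_le.2 ⟨le_max_right _ _, max_le (min_le_right _ _) (by linarith [hw0 n y])⟩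
    have hzero : ∀ y, w n y = 0 → max (min (f y) (w n y)) (-w n y) = 0 := fun y hy => by
      have := habs y
      rw [hy] at this ⊢
      exact abs_nonpos_iff.1 this
    have hR : (1 : ℝ) / ((n : ℝ) + 1) ≤ max K (1 / ((n : ℝ) + 1)) := le_max_right _ _
    have hRpos : (0 : ℝ) ≤ max K (1 / ((n : ℝ) + 1)) := le_trans (by positivity) hR
    -- For a pair with one point where `w n` vanishes, the other value is bounded by `w n y = |w n y
    -- - w n z|`, so no Lipschitz bound on `f` is needed.
    have hone : ∀ y z, w n z = 0 → |max (min (f y) (w n y)) (-w n y)| ≤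
        max K (1 / ((n : ℝ) + 1)) * dist y z := fun y z hz => by
      have h1 := hwd n y z
      rw [hz, sub_zero, abs_of_nonneg (hw0 n y)] at h1
      exact ((habs y).trans h1).trans (by gcongr)
    refine ⟨(max K (1 / ((n : ℝ) + 1))).toNNReal, LipschitzWith.of_dist_le_mul fun y z => ?_⟩
    rw [Real.dist_eq, Real.coe_toNNReal _ hRpos]
    beta_reduce
    by_cases hy : y ∈ Metric.closedBall y₀ (((n : ℝ) + 1) ^ 2)
    · by_cases hz : z ∈ Metric.closedBall y₀ (((n : ℝ) + 1) ^ 2)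
      · have h1 : |f y - f z| ≤ max K (1 / ((n : ℝ) + 1)) * dist y z :=
          (hK y hy z hz).trans (by gcongr; exact le_max_left _ _)
        have h2 : |w n y - w n z| ≤ max K (1 / ((n : ℝ) + 1)) * dist y z :=
          (hwd n y z).trans (by gcongr)
        have h3 : |-w n y - -w n z| ≤ max K (1 / ((n : ℝ) + 1)) * dist y z := by
          rwa [neg_sub_neg, abs_sub_comm]
        exact (abs_max_sub_max_le_max _ _ _ _).trans
          (max_le ((abs_min_sub_min_le_max _ _ _ _).trans (max_le h1 h2)) h3)
      · rw [hzero z (hwzero n z hz), sub_zero]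
        exact hone y z (hwzero n z hz)
    · rw [hzero y (hwzero n y hy), zero_sub, abs_neg, dist_comm]
      exact hone z y (hwzero n y hy)
  · have hb := (hwL n).lipBd
    have h1 : lipAReal (w n) y ≤ 1 / ((n : ℝ) + 1) := by simpa using (hwL n).lipAReal_le y
    have h2 : lipAReal (fun y => -w n y) y ≤ 1 / ((n : ℝ) + 1) :=
      (lipAReal_comp_le (φ := fun t => -t)
        (fun s t => by rw [← abs_neg]; apply le_of_eq; congr 1; ring) hb y).trans h1
    have h3 := lipAReal_nonneg f y
    have h4 : (0 : ℝ) ≤ 1 / ((n : ℝ) + 1) := by positivity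
    refine (lipAReal_max_le (hf.min hb) hb.neg y).trans (max_le ?_ (by linarith))
    exact (lipAReal_min_le hf hb y).trans (max_le (by linarith) (by linarith))
  · obtain ⟨k, hk⟩ := exists_nat_ge (|f y| + dist y y₀)
    refine tendsto_const_nhds.congr' ?_
    filter_upwards [eventually_ge_atTop k] with n hn
    have hkn : (k : ℝ) ≤ n := by exact_mod_cast hn
    have h1 : |f y| ≤ w n y := by
      refine le_trans ?_ (le_max_left _ _)
      have h2 : 1 / ((n : ℝ) + 1) * dist y y₀ ≤ 1 * dist y y₀ := by
        gcongr
        rw [div_le_one (by positivity)]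
        linarith [Nat.cast_nonneg (α := ℝ) n]
      linarith
    obtain ⟨h2, h3⟩ := abs_le.1 h1
    rw [min_eq_left h3, max_eq_left h2]

/-! ### The chain rule for metric-valued maps -/

section ChainRule

variable {X Y : Type*} [MetricSpace X] [MeasurableSpace X] [BorelSpace X] [MetricSpace Y]
  {m : Measure X} {u : X → Y} {G : X → ℝ}

/-- The chain rule for post-composition with a Lipschitz function. -/
theorem minimalWUG_comp_le_of_lipschitz [SigmaFinite m]
    (hm : ∀ B : Set X, Bornology.IsBounded B → m B < ∞)
    (hsep : ∃ N : Set X, m N = 0 ∧ TopologicalSpace.IsSeparable (u '' Nᶜ))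
    (hG : G ∈ mapUpperGradients m u) {K : ℝ≥0} {f : Y → ℝ} (hf : LipschitzWith K f) :
    ∀ᵐ x ∂m, minimalWUG m (f ∘ u) x ≤ lipAReal f (u x) * G x := by
  obtain ⟨N, hN, c, hc, hcl⟩ := hsep
  obtain ⟨hGm, hG0, hGu⟩ := hG
  have hmem := (hGu K f hf).1
  have : Countable c := hc.to_subtype
  have key : ∀ (y : c) (r : ℚ) (q : ℚ), ∀ᵐ x ∂m,
      (∀ z ∈ Metric.ball (y : Y) r, ∀ w ∈ Metric.ball (y : Y) r, |f z - f w| ≤ q * dist z w) →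
      (0 : ℝ) ≤ q → u x ∈ Metric.ball (y : Y) r → minimalWUG m (f ∘ u) x ≤ q * G x := by
    intro y r q
    by_cases H : (∀ z ∈ Metric.ball (y : Y) r, ∀ w ∈ Metric.ball (y : Y) r,
        |f z - f w| ≤ q * dist z w) ∧ (0 : ℝ) ≤ q
    · obtain ⟨H, hq⟩ := H
      have hL : LipschitzOnWith (Real.toNNReal q) f (Metric.ball (y : Y) r) :=
        LipschitzOnWith.of_dist_le_mul fun z hz w hw => by
          rw [Real.dist_eq, Real.coe_toNNReal _ hq]
          exact H z hz w hw
      -- The McShane extension `g` has global constant `q` and agrees with `f` on the ball, so by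
      -- locality its bound passes to `f ∘ u` on the preimage of the ball.
      obtain ⟨g, hg, hfg⟩ := hL.extend_real
      obtain ⟨hg1, hg2⟩ := hGu _ g hg
      filter_upwards [minimalWUG_le_of_eq hm hmem hg1, hg2] with x h1 h2 _ _ hx
      rw [Real.coe_toNNReal _ hq] at h2
      exact (h1 (hfg hx)).trans h2
    · filter_upwards with x h1 h2
      exact absurd ⟨h1, h2⟩ H
  have key' := ae_all_iff.2 fun y => ae_all_iff.2 fun r => ae_all_iff.2 fun q => key y r q
  filter_upwards [key', measure_eq_zero_iff_ae_notMem.1 hN, hG0] with x hx hxN hx0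
  change 0 ≤ G x at hx0
  by_contra! hlt
  -- Where `G x = 0` any rational above `lip_a f` will do; otherwise `q` is found between `lip_a f`
  -- and the quotient by `G x`.
  have hq : ∃ q : ℚ, lipAReal f (u x) < q ∧ q * G x < minimalWUG m (f ∘ u) x := by
    rcases hx0.eq_or_lt with h0 | h0
    · obtain ⟨q, hq⟩ := exists_rat_gt (lipAReal f (u x))
      refine ⟨q, hq, ?_⟩
      rw [← h0, mul_zero] at hlt ⊢
      exact hlt
    · obtain ⟨q, h1, h2⟩ := exists_rat_btwn ((lt_div_iff₀ h0).2 hlt)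
      exact ⟨q, h1, (lt_div_iff₀ h0).1 h2⟩
  obtain ⟨q, hq1, hq2⟩ := hq
  obtain ⟨U, hU, hUq⟩ := hf.lipBd.lipNear hq1
  obtain ⟨ρ, hρ, hρU⟩ := Metric.mem_nhds_iff.1 hU
  -- The radius is less than `ρ / 2`, so a ball of radius `r` about a dense point that contains `u
  -- x` stays within distance `ρ` of `u x`.
  obtain ⟨r, hr0, hr⟩ := exists_rat_btwn (half_pos hρ)
  obtain ⟨y, hy, hyr⟩ := Metric.mem_closure_iff.1 (hcl ⟨x, hxN, rfl⟩) r hr0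
  have hsub : Metric.ball y (r : ℝ) ⊆ U := fun z hz => hρU (by
    rw [Metric.mem_ball] at hz ⊢
    have := dist_triangle z y (u x)
    rw [dist_comm y] at this
    linarith)
  have := hx ⟨y, hy⟩ r q (fun z hz w hw => hUq z (hsub hz) w (hsub hw))
    ((lipAReal_nonneg _ _).trans hq1.le) hyr
  linarith

/-- The chain rule for post-composition with a function in `LIP_bd`. -/
theorem LipBd.approxSlope_comp [SigmaFinite m]
    (hm : ∀ B : Set X, Bornology.IsBounded B → m B < ∞)
    (hsep : ∃ N : Set X, m N = 0 ∧ TopologicalSpace.IsSeparable (u '' Nᶜ))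
    (hG : G ∈ mapUpperGradients m u) {f : Y → ℝ} (hf : LipBd f)
    (hfG : MemLp (fun x => lipAReal f (u x) * G x) 2 m) :
    ApproxSlope m.toFinite m (f ∘ u) (fun x => lipAReal f (u x) * G x) := by
  obtain ⟨h, hL, hlip, hlim⟩ := exists_lipschitz_approx_of_lipBd hf
  choose K hK using hL
  refine ApproxSlope.of_tendsto (fn := fun n => h n ∘ u) (Gn := fun n => minimalWUG m (h n ∘ u))
    (r := fun n => (1 / ((n : ℝ) + 1)) • G) (fun n => ?_) hfG (fun n => hG.1.const_smul _) ?_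
    (fun n => ?_) (ae_of_all _ fun x => hlim (u x))
  · exact (((hG.2.2 _ _ (hK n)).1).minimalWUG_spec hm (absolutelyContinuous_toFinite m)
      (toFinite_absolutelyContinuous m)).2.1
  · simp only [eLpNorm_const_smul]
    have h1 : Tendsto (fun n : ℕ => ‖1 / ((n : ℝ) + 1)‖ₑ) atTop (𝓝 0) := by
      simpa using (tendsto_one_div_add_atTop_nhds_zero_nat (𝕜 := ℝ)).enorm
    simpa using ENNReal.Tendsto.mul_const h1 (Or.inr hG.1.2.ne)
  · filter_upwards [minimalWUG_comp_le_of_lipschitz hm hsep hG (hK n), hG.2.1] with x hx hx0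
    have := mul_le_mul_of_nonneg_right (hlip n (u x)) (show 0 ≤ G x from hx0)
    rw [add_mul] at this
    exact hx.trans this

end ChainRule

/-- The defining bounds are pointwise inequalities for fixed functions `f ∘ u`, so they pass to
minima and to `L²` limits along a subsequence converging almost everywhere. -/
theorem isLeastAE_mapWUG {X Y : Type*} [MetricSpace X] [MeasurableSpace X] [MetricSpace Y]
    {m : Measure X} {u : X → Y} (hne : (mapUpperGradients m u).Nonempty) :
    IsLeastAE m (mapUpperGradients m u) (mapWUG m u) := by
  refine isLeastAE_leastAE (exists_isLeastAE hne (fun G hG => hG.1) (fun G hG => hG.2.1)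
    (fun G hG G' hG' => ⟨hG.1.inf hG'.1, ?_, fun K f hf => ⟨(hG.2.2 K f hf).1, ?_⟩⟩)
    fun Gn G hGn hGm hlim => ?_)
  · filter_upwards [hG.2.1, hG'.2.1] with x h1 h2
    exact le_min h1 h2
  · filter_upwards [(hG.2.2 K f hf).2, (hG'.2.2 K f hf).2] with x h1 h2
    rcases min_choice (G x) (G' x) with h | h <;> rw [h] <;> assumption
  · obtain ⟨φ, -, hφ⟩ := (tendstoInMeasure_of_tendsto_eLpNorm (by norm_num)
      (fun n => (hGn n).1.1) hGm.1 hlim).exists_seq_tendsto_ae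
    refine ⟨hGm, ?_, fun K f hf => ⟨((hGn 0).2.2 K f hf).1, ?_⟩⟩
    · filter_upwards [hφ, ae_all_iff.2 fun n => (hGn n).2.1] with x h1 h2
      exact ge_of_tendsto' h1 fun n => h2 _
    · filter_upwards [hφ, ae_all_iff.2 fun n => ((hGn n).2.2 K f hf).2] with x h1 h2
      exact ge_of_tendsto' (h1.const_mul (K : ℝ)) fun n => h2 _

/-! ### The energy measure and the isometry `h ↦ h ∘ u |Du|` -/

section EnergyMeasure

variable {X Y : Type*} [MetricSpace X] [MeasurableSpace X] [MetricSpace Y] [MeasurableSpace Y]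
  {m : Measure X} {u : X → Y}

theorem isFiniteMeasure_energyMeasure (hD : MemLp (mapWUG m u) 2 m) :
    IsFiniteMeasure (energyMeasure m u) := by
  have := isFiniteMeasure_withDensity_ofReal hD.integrable_sq.2
  unfold energyMeasure
  infer_instance

theorem energyMeasure_absolutelyContinuous [SFinite m] (hu : Measurable u) :
    energyMeasure m u ≪ m.toFinite.map u :=
  ((withDensity_absolutelyContinuous m _).trans (absolutelyContinuous_toFinite m)).map hu

theorem ae_of_ae_energyMeasure (hu : Measurable u) (hD : MemLp (mapWUG m u) 2 m) {p : Y → Prop}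
    (h : ∀ᵐ y ∂energyMeasure m u, p y) : ∀ᵐ x ∂m, 0 < mapWUG m u x → p (u x) := by
  have h1 := ae_of_ae_map hu.aemeasurable h
  rw [ae_withDensity_iff' (hD.1.aemeasurable.pow_const 2).ennreal_ofReal] at h1
  filter_upwards [h1] with x hx hpos
  exact hx (ENNReal.ofReal_pos.2 (pow_pos hpos 2)).ne'

/-- `h ∘ u` alone is controlled only on `{|Du| > 0}`; elsewhere the factor `|Du|` makes the product
vanish whatever `h` is. -/
theorem aestronglyMeasurable_comp_mul_mapWUG (hu : Measurable u) (hD : MemLp (mapWUG m u) 2 m)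
    (hD0 : 0 ≤ᵐ[m] mapWUG m u) {h : Y → ℝ} (hh : AEStronglyMeasurable h (energyMeasure m u)) :
    AEStronglyMeasurable (fun x => h (u x) * mapWUG m u x) m := by
  refine AEStronglyMeasurable.congr (f := fun x => hh.mk h (u x) * mapWUG m u x)
    ((hh.stronglyMeasurable_mk.comp_measurable hu).aestronglyMeasurable.mul hD.1) ?_
  filter_upwards [ae_of_ae_energyMeasure hu hD hh.ae_eq_mk, hD0] with x hx hx0
  rcases (show 0 ≤ mapWUG m u x from hx0).eq_or_lt with h0 | h0
  · simp [← h0]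
  · rw [hx h0]

/-- Change of variables: `∫ |h ∘ u|² |Du|² dm = ∫ |h|² dμ`. This is why `μ` has the density `|Du|²`.
-/
theorem eLpNorm_comp_mul_mapWUG (hu : Measurable u) (hD : MemLp (mapWUG m u) 2 m) {h : Y → ℝ}
    (hh : AEStronglyMeasurable h (energyMeasure m u)) :
    eLpNorm (fun x => h (u x) * mapWUG m u x) 2 m = eLpNorm h 2 (energyMeasure m u) := by
  have h1 : AEMeasurable (fun y => ‖h y‖ₑ ^ (2 : ℝ)) (energyMeasure m u) := hh.enorm.pow_const _
  have h2 := h1.comp_measurable hu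
  have h3 := lintegral_withDensity_eq_lintegral_mul₀'
    (hD.1.aemeasurable.pow_const 2).ennreal_ofReal h2
  simp only [Function.comp_apply] at h3
  rw [eLpNorm_two_eq, eLpNorm_two_eq, energyMeasure, lintegral_map' h1 hu.aemeasurable, h3]
  congr 1
  refine lintegral_congr fun x => ?_
  have e : ENNReal.ofReal (mapWUG m u x ^ 2) = ‖mapWUG m u x‖ₑ ^ (2 : ℝ) := by
    rw [← Real.enorm_of_nonneg (sq_nonneg _), enorm_pow]
    norm_cast
  rw [Pi.mul_apply, e, enorm_mul, ENNReal.mul_rpow_of_nonneg _ _ (by norm_num), mul_comm]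
  rfl

theorem TendstoStrongL2.comp_mul_mapWUG (hu : Measurable u) (hD : MemLp (mapWUG m u) 2 m)
    (hD0 : 0 ≤ᵐ[m] mapWUG m u) {Gn : ℕ → Y → ℝ} {G : Y → ℝ}
    (h : TendstoStrongL2 (energyMeasure m u) Gn G) :
    TendstoStrongL2 m (fun n x => Gn n (u x) * mapWUG m u x)
      (fun x => G (u x) * mapWUG m u x) := by
  have hmem : ∀ {k : Y → ℝ}, MemLp k 2 (energyMeasure m u) →
      MemLp (fun x => k (u x) * mapWUG m u x) 2 m := fun hk =>
    ⟨aestronglyMeasurable_comp_mul_mapWUG hu hD hD0 hk.1,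
      (eLpNorm_comp_mul_mapWUG hu hD hk.1).trans_lt hk.2⟩
  refine ⟨fun n => hmem (h.1 n), hmem h.2.1, h.2.2.congr fun n => ?_⟩
  refine (eLpNorm_comp_mul_mapWUG hu hD ((h.1 n).1.sub h.2.1.1)).symm.trans ?_
  congr 1
  ext x
  exact sub_mul _ _ _

end EnergyMeasure

/-! ### The proposition -/

theorem proposition3p3 {X Y : Type*}
    [MetricSpace X] [CompleteSpace X] [TopologicalSpace.SeparableSpace X]
    [MeasurableSpace X] [BorelSpace X]
    [MetricSpace Y] [CompleteSpace Y] [MeasurableSpace Y] [BorelSpace Y]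
    (m : Measure X) (hm : ∀ B : Set X, Bornology.IsBounded B → m B < ∞)
    (u : X → Y) (hu : MemS2Map m u) :
    -- `|D u|` exists
    IsLeastAE m (mapUpperGradients m u) (mapWUG m u) ∧
    ∀ f : Y → ℝ, MemS2 (energyMeasure m u) f →
      -- `|d_μ f|` exists
      IsLeastAE (energyMeasure m u) (relaxedSlopes (energyMeasure m u) f)
        (minimalWUG (energyMeasure m u) f) ∧
      ∃ g : X → ℝ, MemS2 m g ∧
        -- `|d g|` exists
        IsLeastAE m (relaxedSlopes m g) (minimalWUG m g) ∧
        (∀ᵐ x ∂m, 0 < mapWUG m u x → g x = f (u x)) ∧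
        (∀ᵐ x ∂m, minimalWUG m g x ≤ minimalWUG (energyMeasure m u) f (u x) * mapWUG m u x) ∧
        ∃ fn : ℕ → Y → ℝ, (∀ n, LipBd (fn n)) ∧
          (∀ᵐ y ∂(energyMeasure m u), Tendsto (fun n => fn n y) atTop (𝓝 (f y))) ∧
          TendstoStrongL2 (energyMeasure m u) (fun n => lipAReal (fn n))
            (minimalWUG (energyMeasure m u) f) ∧
          (∀ᵐ x ∂m, Tendsto (fun n => fn n (u x)) atTop (𝓝 (g x))) ∧
          TendstoStrongL2 m (fun n x => lipAReal (fn n) (u x) * mapWUG m u x)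
            (fun x => minimalWUG (energyMeasure m u) f (u x) * mapWUG m u x) := by
  obtain ⟨hum, hsep, hne⟩ := hu
  have : SigmaFinite m := sigmaFinite_of_isBounded hm
  have hDu := isLeastAE_mapWUG hne
  have hD := hDu.1.1
  have hD0 := hDu.1.2.1
  refine ⟨hDu, fun f hf => ?_⟩
  have : IsFiniteMeasure (energyMeasure m u) := isFiniteMeasure_energyMeasure hD
  have hac := energyMeasure_absolutelyContinuous (m := m) hum
  set μ := energyMeasure m u
  -- The measure `μ` is finite, so it can itself serve as the measure for convergence of functions.
  obtain ⟨hrel, hleast⟩ := hf.minimalWUG_spec (ν := μ) (fun B _ => measure_lt_top μ B)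
    Measure.AbsolutelyContinuous.rfl Measure.AbsolutelyContinuous.rfl
  refine ⟨hrel, ?_⟩
  -- Convergence for the push-forward of a finite measure equivalent to `m` is what gives
  -- convergence of `f_n ∘ u` `m`-a.e., also where `|Du| = 0`.
  obtain ⟨g, hgf, hg⟩ := ApproxSlope.exists_extension (ν := m.toFinite.map u) hleast.1
  obtain ⟨h, r, hS, hlim, -⟩ := hg.exists_seq
  have hlimf : ∀ᵐ y ∂μ, Tendsto (fun n => h n y) atTop (𝓝 (f y)) := by
    filter_upwards [hac.ae_le hlim, hgf] with y h1 h2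
    rwa [← h2]
  -- The sequence obtained for the larger measure still approximates `f` with respect to `μ`, so
  -- minimality of `|d_μ f|` upgrades its slopes to strong convergence along a subsequence.
  obtain ⟨φ, hφ, hstrong⟩ := hS.exists_tendstoStrongL2 hleast hlimf
  have hlimg : ∀ᵐ x ∂m, Tendsto (fun n => h (φ n) (u x)) atTop (𝓝 (g (u x))) := by
    rw [← ae_toFinite]
    filter_upwards [ae_of_ae_map hum.aemeasurable hlim] with x hx
    exact hx.comp hφ
  have hpull := hstrong.comp_mul_mapWUG hum hD hD0
  -- The chain rule holds for each approximant, and slopes are closed under the two convergences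
  -- just obtained.
  have hslope : ApproxSlope m.toFinite m (g ∘ u) (fun x => minimalWUG μ f (u x) * mapWUG m u x) :=
    .of_tendsto (fun n => (hS.lipBd (φ n)).approxSlope_comp hm hsep hDu.1 (hpull.1 n)) hpull.2.1
      (fun n => (hpull.1 n).sub hpull.2.1) hpull.2.2 (fun n => ae_of_all _ fun x => by simp)
      (by rw [ae_toFinite]; exact hlimg)
  obtain ⟨hg1, hg2, hg3⟩ := hslope.minimalWUG_spec hm (absolutelyContinuous_toFinite m)
    (toFinite_absolutelyContinuous m)
  refine ⟨g ∘ u, hg1, hg2, ae_of_ae_energyMeasure hum hD hgf, hg3.2 _ hslope,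
    fun n => h (φ n), fun n => hS.lipBd _, ?_, hstrong, hlimg, hpull⟩
  filter_upwards [hlimf] with y hy
  exact hy.comp hφ
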